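/- Let $\mathbb F_q$ be a finite field with $q$ elements. For $n\ge 0$ let $\mathcal T_n$ be the set of orbits of $\mathrm{GL}(n,\mathbb F_q)$ acting by conjugation on $\mathfrak{gl}(n,\mathbb F_q)=\mathrm{Mat}_{n\times n}(\mathbb F_q)$. **Graphs.** For a graph $\Gamma$ with finite levels $V_0,V_1,\dots$ and edge weights $\tau(w,v)$, $w\in V_{n+1}$, $v\in V_n$ (with $\tau=0$ on non-edges), let $\mathrm{Harm}_{\ge0}(\Gamma)$ be the convex cone of functions $F:\bigsqcup_n V_n\to\mathbb R_{\ge0}$ with $F(v)=\sum_{w\in V_{n+1}}\tau(w,v)F(w)$ for all $n\ge0$, $v\in V_n$. * $\Gamma^{\mathbb{GLB}}$ has levels $\mathcal T_n$ and weights $$L^{n+1}_n(\lambda,\mu)=\#\Big\{x\in\mathbb F_q^n:\ \begin{bmatrix}X_\mu&x\\0&0\end{bmatrix}\in\lambda\Big\},\qquad \lambda\in\mathcal T_{n+1},\ \mu\in\mathcal T_n,$$ where $X_\mu$ is any matrix in $\mu$. $\Gamma^{\mathbb{GLB}}_0$ has as its $n$-th level the set of nilpotent orbits in $\mathcal T_n$,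 with the same weights. * $\mathbb Y^{HL}(t)$, $0<t<1$, has as its $n$-th level the set of partitions of $n$, and an edge joins $\mu$ and $\lambda$ when the Young diagram of $\lambda$ is that of $\mu$ with one box added. The weight of this edge is the coefficient $\psi_{\lambda/\mu}(t)$ in the expansion $$(1-t)\,p_1\cdot Q_\mu(\,\cdot\,;t)=\sum_{|\lambda|=n+1}\psi_{\lambda/\mu}(t)\,Q_\lambda(\,\cdot\,;t),\qquad |\mu|=n,$$ in the algebra of symmetric functions, where $p_1$ is the first power sum and the $Q_\lambda(\,\cdot\,;t)$ are the ($Q$-normalised) Hall–Littlewood symmetric functions. **Functionals.** Let $\mathcal C(\mathfrak{gl}(n,\mathbb F_q))$ be the space of real conjugation-invariant functions on $\mathfrak{gl}(n,\mathbb F_q)$, and $A_q=\bigoplus_{n\ge0}\mathcal C(\mathfrak{gl}(n,\mathbb F_q))$. Let $\nabla:A_q\otimes A_q\to A_q$ be the linear map that is parabolic induction in each bidegree: for $f\in\mathcal C(\mathfrak{gl}(i,\mathbb F_q))$ and $g\in\mathcal C(\mathfrak{gl}(j,\mathbb F_q))$, $$\nabla(f\otimes g)(X)=\sum_{h\in \mathrm{GL}(i+j,\mathbb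 F_q)/P_{i,j}}\Phi'(h^{-1}Xh),\qquad X\in\mathfrak{gl}(i+j,\mathbb F_q),$$ where $P_{i,j}$ is the subgroup of block upper triangular matrices with diagonal blocks of sizes $i,j$, $\Phi'\begin{bmatrix}A&C\\0&B\end{bmatrix}=f(A)g(B)$, and $\Phi'=0$ on matrices that are not block upper triangular. Let $\chi_\lambda\in A_q$ be the indicator function of the orbit $\lambda$, and let $x_1$ be the indicator function of the $1\times1$ zero matrix. Let $\mathcal F(A_q)$ be the convex cone of linear functionals $\varphi:A_q\to\mathbb R$ such that $\varphi(\chi_\lambda)\ge0$ for every orbit $\lambda\in\bigsqcup_n\mathcal T_n$ and $\varphi(a)=\varphi(\nabla(x_1\otimes a))$ for all $a\in A_q$. Let $\mathcal F_0(A_q)$ be the subcone of those $\varphi\in\mathcal F(A_q)$ with $\varphi(\chi_\lambda)=0$ for every non-nilpotent orbit $\lambda$. **Proposition.** $\mathrm{Harm}_{\ge0}(\Gamma^{\mathbb{GLB}})$ and $\mathcal F(A_q)$ are isomorphic as convex cones. Also, $\mathrm{Harm}_{\ge0}(\Gamma^{\mathbb{GLB}}_0)$, $\mathrm{Harm}_{\ge0}(\mathbb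 Y^{HL}(q^{-1}))$ and $\mathcal F_0(A_q)$ are isomorphic as convex cones. -/

import Mathlib

open scoped DirectSum TensorProduct

namespace GLBHarmonic

noncomputable section

universe u

/-! ### Weighted graded graphs and positive harmonic functions -/

/-- A graded graph with finite levels and real edge weights. The weight is recorded as a function
on all pairs of vertices of adjacent levels; it is `0` on the pairs that are not joined by an edge,
so that the edges are the pairs of nonzero weight. -/
structure WeightedGradedGraph where
  level : ℕ → Type u
  fintypeLevel : ∀ n, Fintype (level n)
  weight : ∀ n, level (n + 1) → level n → ℝ

attribute [instance] WeightedGradedGraph.fintypeLevel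

/-- The convex cone of positive harmonic functions on `Γ`: the nonnegative functions on the vertices
with `f v = ∑ w, τ(w, v) f(w)`, the sum being over the vertices `w` one level above `v`. -/
def Harm (Γ : WeightedGradedGraph.{u}) : PointedCone ℝ (∀ n, Γ.level n → ℝ) where
  carrier := {f | (∀ n v, 0 ≤ f n v) ∧ ∀ n v, f n v = ∑ w, Γ.weight n w v * f (n + 1) w}
  add_mem' := by
    rintro f g ⟨hf, hf'⟩ ⟨hg, hg'⟩
    refine ⟨fun n v => add_nonneg (hf n v) (hg n v), fun n v => ?_⟩
    simp only [Pi.add_apply, mul_add, Finset.sum_add_distrib, ← hf', ← hg']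
  zero_mem' := ⟨fun _ _ => le_rfl, fun _ _ => by simp⟩
  smul_mem' := by
    rintro c f ⟨hf, hf'⟩
    refine ⟨fun n v => mul_nonneg c.2 (hf n v), fun n v => ?_⟩
    change (c : ℝ) * f n v = ∑ w, Γ.weight n w v * ((c : ℝ) * f (n + 1) w)
    rw [hf' n v, Finset.mul_sum]
    exact Finset.sum_congr rfl fun w _ => by ring

/-! ### Orbits of matrices and the graphs of invariant measures -/

/-- Square matrices of size `n`. -/
abbrev Mat (F : Type u) (n : ℕ) : Type u := Matrix (Fin n) (Fin n) F

/-- The set of orbits of `GL(n, F)` acting by conjugation on the `n × n` matrices (`IsConj` in a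
monoid is conjugacy by a unit, so these are the conjugacy classes of the matrix monoid). -/
abbrev Orbit (F : Type u) [Field F] (n : ℕ) : Type u := ConjClasses (Mat F n)

/-- The orbit consists of nilpotent matrices. -/
def IsNilpotentOrbit {F : Type u} [Field F] {n : ℕ} (l : Orbit F n) : Prop :=
  ∀ X : Mat F n, ConjClasses.mk X = l → IsNilpotent X

/-- The block matrix with rows `(X, x)` and `(0, 0)`. -/
def bordered {F : Type u} [Field F] {n : ℕ} (X : Mat F n) (x : Fin n → F) : Mat F (n + 1) :=
  Matrix.reindex finSumFinEquiv finSumFinEquiv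
    (Matrix.fromBlocks X (Matrix.replicateCol (Fin 1) x) 0 0)

/-- The number of columns `x` such that `[X x; 0 0]` lies in the orbit `l`, for a representative `X`
of the orbit `m`. -/
def link {F : Type u} [Field F] (n : ℕ) (l : Orbit F (n + 1)) (m : Orbit F n) : ℕ :=
  Nat.card {x : Fin n → F // ConjClasses.mk (bordered (Quotient.out m) x) = l}

/-- The graph `Γ^GLB`. -/
def gammaGLB (F : Type u) [Field F] [Fintype F] : WeightedGradedGraph.{u} where
  level := Orbit F
  fintypeLevel := fun _ => Fintype.ofFinite _
  weight := fun n l m => (link n l m : ℝ)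

/-- The graph `Γ₀^GLB`: the part of `Γ^GLB` spanned by the nilpotent orbits. -/
def gammaGLBZero (F : Type u) [Field F] [Fintype F] : WeightedGradedGraph.{u} where
  level := fun n => {l : Orbit F n // IsNilpotentOrbit l}
  fintypeLevel := fun _ => Fintype.ofFinite _
  weight := fun n l m => (link n l.1 m.1 : ℝ)

/-! ### Hall-Littlewood functions and the deformed Young graph -/

/-- The `i`-th part of a partition in weakly decreasing order, counted from `0`, and `0` beyond the
length of the partition. -/
def part {n : ℕ} (l : n.Partition) (i : ℕ) : ℕ := (l.parts.sort (· ≥ ·)).getD i 0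

/-- The length of a partition, i.e. its number of nonzero parts. -/
def len {n : ℕ} (l : n.Partition) : ℕ := l.parts.card

/-- The multiplicity of `j` as a part of the partition. -/
def mult {n : ℕ} (l : n.Partition) (j : ℕ) : ℕ := l.parts.count j

/-- The field of rational functions in `x_0, …, x_{N-1}` with real coefficients. -/
abbrev RatFun (N : ℕ) : Type := FractionRing (MvPolynomial (Fin N) ℝ)

/-- The variable `x_i` as a rational function. -/
def var {N : ℕ} (i : Fin N) : RatFun N :=
  algebraMap (MvPolynomial (Fin N) ℝ) (RatFun N) (MvPolynomial.X i)

/-- `φ_m(t) = (1 - t)(1 - t²)⋯(1 - t^m)`. -/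
def phi (t : ℝ) (m : ℕ) : ℝ := ∏ i ∈ Finset.Icc 1 m, (1 - t ^ i)

/-- `v_m(t) = φ_m(t) / (1 - t)^m`. -/
def vfac (t : ℝ) (m : ℕ) : ℝ := ∏ i ∈ Finset.Icc 1 m, (1 - t ^ i) / (1 - t)

/-- The Hall-Littlewood polynomial `P_l(x_0, …, x_{N-1}; t)` for a partition `l` of length at
most `N`: the sum over all permutations `w` of
`w (x^l ∏_{i<j} (x_i - t x_j) / (x_i - x_j))`, divided by `v_l(t) = ∏_{j ≥ 0} v_{m_j}(t)`, where
`m_0 = N - len l`. -/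
def hallLittlewoodP (t : ℝ) {n : ℕ} (l : n.Partition) (N : ℕ) : RatFun N :=
  (vfac t (N - len l) * ∏ j ∈ Finset.Icc 1 n, vfac t (mult l j))⁻¹ •
    ∑ w : Equiv.Perm (Fin N),
      (∏ i, var (w i) ^ part l i) *
        ∏ i, ∏ j ∈ Finset.Ioi i, (var (w i) - t • var (w j)) / (var (w i) - var (w j))

/-- Symmetric functions are represented by the family of their specialisations to `N` variables,
for all `N`; the algebra of symmetric functions is a subalgebra of the algebra of all families. -/
abbrev FuncFamily : Type := ∀ N : ℕ, RatFun N

/-- The Hall-Littlewood function `Q_l(; t) = b_l(t) P_l(; t)` with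
`b_l(t) = ∏_{j ≥ 1} φ_{m_j}(t)`. Its specialisation to fewer than `len l` variables is `0`. -/
def hallLittlewoodQ (t : ℝ) {n : ℕ} (l : n.Partition) : FuncFamily := fun N =>
  if len l ≤ N then (∏ j ∈ Finset.Icc 1 n, phi t (mult l j)) • hallLittlewoodP t l N else 0

/-- The power sum `p_1 = x_0 + x_1 + ⋯`. -/
def powerSumOne : FuncFamily := fun N => ∑ i : Fin N, var i

open Classical in
/-- The coefficients of the expansion
`(1 - t) p_1 · Q_m(; t) = ∑_l ψ_{l/m}(t) Q_l(; t)`, `l` running over the partitions of `n + 1`;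
note that `(1 - t) p_1 = Q_{(1)}(; t)`. -/
def psi (t : ℝ) {n : ℕ} (m : n.Partition) : (n + 1).Partition → ℝ :=
  if h : ∃ c : (n + 1).Partition → ℝ,
      ((1 - t) • powerSumOne) * hallLittlewoodQ t m = ∑ l, c l • hallLittlewoodQ t l
  then h.choose else 0

/-- Inclusion of Young diagrams. For partitions of consecutive sizes this says that `l` is obtained
from `m` by adding one box. -/
def DiagramLE {k n : ℕ} (m : k.Partition) (l : n.Partition) : Prop := ∀ i, part m i ≤ part l i

open Classical in
/-- The HL-deformed Young graph `Y^HL(t)`: the Young graph with multiplicities `ψ_{l/m}(t)`. -/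
def hlYoungGraph (t : ℝ) : WeightedGradedGraph.{0} where
  level := fun n => n.Partition
  fintypeLevel := fun _ => inferInstance
  weight := fun _ l m => if DiagramLE m l then psi t m l else 0

/-! ### Invariant functions and parabolic induction -/

/-- The space of real functions on the `n × n` matrices that are invariant under conjugation. -/
def invFun (F : Type u) [Field F] (n : ℕ) : Submodule ℝ (Mat F n → ℝ) where
  carrier := {f | ∀ (g : GL (Fin n) F) (X : Mat F n),
    f ((g : Mat F n) * X * ((g⁻¹ : GL (Fin n) F) : Mat F n)) = f X}
  add_mem' := fun hf hg g X => by rw [Pi.add_apply, Pi.add_apply, hf g X, hg g X]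
  zero_mem' := fun _ _ => rfl
  smul_mem' := fun c f hf g X => by rw [Pi.smul_apply, Pi.smul_apply, hf g X]

/-- The `2 × 2` block form of a matrix of size `i + j`. -/
def blocks {F : Type u} [Field F] {i j : ℕ} (X : Mat F (i + j)) :
    Matrix (Fin i ⊕ Fin j) (Fin i ⊕ Fin j) F :=
  Matrix.reindex finSumFinEquiv.symm finSumFinEquiv.symm X

/-- The matrices that are block upper triangular: the Lie algebra of the parabolic subgroup. -/
def IsParabolic {F : Type u} [Field F] {i j : ℕ} (X : Mat F (i + j)) : Prop :=
  (blocks X).toBlocks₂₁ = 0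

section Aux

variable {F : Type u} [Field F] {i j : ℕ}

theorem blocks_mul (X Y : Mat F (i + j)) : blocks (X * Y) = blocks X * blocks Y := by
  simp [blocks, Matrix.submatrix_mul_equiv]

theorem blocks_one : blocks (1 : Mat F (i + j)) = 1 := by
  simp [blocks]

theorem block₁₁_mul (X Y : Mat F (i + j)) (hY : IsParabolic Y) :
    (blocks (X * Y)).toBlocks₁₁ = (blocks X).toBlocks₁₁ * (blocks Y).toBlocks₁₁ := by
  unfold IsParabolic at hY
  rw [blocks_mul]
  conv_lhs => rw [← Matrix.fromBlocks_toBlocks (blocks X), ← Matrix.fromBlocks_toBlocks (blocks Y),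
    Matrix.fromBlocks_multiply, Matrix.toBlocks_fromBlocks₁₁, hY]
  simp

theorem block₂₂_mul (X Y : Mat F (i + j)) (hX : IsParabolic X) :
    (blocks (X * Y)).toBlocks₂₂ = (blocks X).toBlocks₂₂ * (blocks Y).toBlocks₂₂ := by
  unfold IsParabolic at hX
  rw [blocks_mul]
  conv_lhs => rw [← Matrix.fromBlocks_toBlocks (blocks X), ← Matrix.fromBlocks_toBlocks (blocks Y),
    Matrix.fromBlocks_multiply, Matrix.toBlocks_fromBlocks₂₂, hX]
  simp

theorem block₂₁_mul (X Y : Mat F (i + j)) (hY : IsParabolic Y) :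
    (blocks (X * Y)).toBlocks₂₁ = (blocks X).toBlocks₂₁ * (blocks Y).toBlocks₁₁ := by
  unfold IsParabolic at hY
  rw [blocks_mul]
  conv_lhs => rw [← Matrix.fromBlocks_toBlocks (blocks X), ← Matrix.fromBlocks_toBlocks (blocks Y),
    Matrix.fromBlocks_multiply, Matrix.toBlocks_fromBlocks₂₁, hY]
  simp

theorem isParabolic_one : IsParabolic (1 : Mat F (i + j)) := by
  unfold IsParabolic
  rw [blocks_one, ← Matrix.fromBlocks_one, Matrix.toBlocks_fromBlocks₂₁]

theorem IsParabolic.mul {X Y : Mat F (i + j)} (hX : IsParabolic X) (hY : IsParabolic Y) :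
    IsParabolic (X * Y) := by
  unfold IsParabolic at hX ⊢
  rw [block₂₁_mul _ _ hY, hX, Matrix.zero_mul]

theorem IsParabolic.of_mul_eq_one {X Y : Mat F (i + j)} (hX : IsParabolic X) (h : Y * X = 1) :
    IsParabolic Y := by
  have h1 := block₁₁_mul Y X hX
  have h2 := block₂₁_mul Y X hX
  rw [h] at h1 h2
  rw [isParabolic_one] at h2
  rw [blocks_one, ← Matrix.fromBlocks_one, Matrix.toBlocks_fromBlocks₁₁] at h1
  have h3 := mul_eq_one_comm.mp h1.symm
  unfold IsParabolic
  calc (blocks Y).toBlocks₂₁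
      = (blocks Y).toBlocks₂₁ * ((blocks X).toBlocks₁₁ * (blocks Y).toBlocks₁₁) := by
        rw [h3, Matrix.mul_one]
    _ = 0 := by rw [← Matrix.mul_assoc, ← h2, Matrix.zero_mul]

end Aux

/-- The maximal parabolic subgroup of `GL(i + j, F)` of block upper triangular matrices. -/
def parabolic (F : Type u) [Field F] (i j : ℕ) : Subgroup (GL (Fin (i + j)) F) where
  carrier := {g | IsParabolic (g : Mat F (i + j))}
  mul_mem' := fun {a b} ha hb => by
    change IsParabolic ((a * b : GL (Fin (i + j)) F) : Mat F (i + j))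
    rw [Units.val_mul]
    exact ha.mul hb
  one_mem' := isParabolic_one
  inv_mem' := fun {a} ha => IsParabolic.of_mul_eq_one ha a.inv_mul

open Classical in
/-- The function on the block diagonal matrices given by `f` and `g` on the two diagonal blocks,
extended to the block upper triangular matrices along the projection, and then by `0`. -/
def extend {F : Type u} [Field F] {i j : ℕ} (f : Mat F i → ℝ) (g : Mat F j → ℝ)
    (X : Mat F (i + j)) : ℝ :=
  if IsParabolic X then f (blocks X).toBlocks₁₁ * g (blocks X).toBlocks₂₂ else 0

/-- Conjugation `X ↦ g⁻¹ X g`. -/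
def conjInv {F : Type u} [Field F] {n : ℕ} (g : GL (Fin n) F) (X : Mat F n) : Mat F n :=
  ((g⁻¹ : GL (Fin n) F) : Mat F n) * X * (g : Mat F n)

theorem conjInv_mul {F : Type u} [Field F] {n : ℕ} (g h : GL (Fin n) F) (X : Mat F n) :
    conjInv (g * h) X = conjInv h (conjInv g X) := by
  simp only [conjInv, mul_inv_rev, Units.val_mul, Matrix.mul_assoc]

theorem conjInv_one {F : Type u} [Field F] {n : ℕ} (X : Mat F n) : conjInv 1 X = X := by
  simp [conjInv]

theorem invFun_of_mul_eq_one {F : Type u} [Field F] {n : ℕ} (f : invFun F n) {A B : Mat F n}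
    (h : A * B = 1) (X : Mat F n) : f.1 (A * X * B) = f.1 X :=
  f.2 ⟨A, B, h, mul_eq_one_comm.mp h⟩ X

theorem extend_conjInv {F : Type u} [Field F] {i j : ℕ} (f : invFun F i) (g : invFun F j)
    {p : GL (Fin (i + j)) F} (hp : p ∈ parabolic F i j) (X : Mat F (i + j)) :
    extend f.1 g.1 (conjInv p X) = extend f.1 g.1 X := by
  have key : ∀ {p : GL (Fin (i + j)) F}, p ∈ parabolic F i j → ∀ X, IsParabolic X →
      IsParabolic (conjInv p X) := by
    intro p hp X hX
    have hp' : IsParabolic ((p⁻¹ : GL (Fin (i + j)) F) : Mat F (i + j)) :=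
      (parabolic F i j).inv_mem hp
    exact (hp'.mul hX).mul hp
  by_cases hX : IsParabolic X
  · have hp' : IsParabolic ((p⁻¹ : GL (Fin (i + j)) F) : Mat F (i + j)) :=
      (parabolic F i j).inv_mem hp
    have hp0 : IsParabolic (p : Mat F (i + j)) := hp
    have e1 := block₁₁_mul ((p⁻¹ : GL (Fin (i + j)) F) : Mat F (i + j)) _ hp0
    have e2 := block₂₂_mul _ (p : Mat F (i + j)) hp'
    rw [p.inv_mul, blocks_one, ← Matrix.fromBlocks_one] at e1 e2
    rw [Matrix.toBlocks_fromBlocks₁₁] at e1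
    rw [Matrix.toBlocks_fromBlocks₂₂] at e2
    rw [extend, extend, if_pos (key hp X hX), if_pos hX, conjInv, block₁₁_mul _ _ hp0,
      block₁₁_mul _ _ hX, block₂₂_mul _ _ (hp'.mul hX), block₂₂_mul _ _ hp',
      invFun_of_mul_eq_one f e1.symm, invFun_of_mul_eq_one g e2.symm]
  · have hX' : ¬ IsParabolic (conjInv p X) := fun h => hX <| by
      have := key ((parabolic F i j).inv_mem hp) _ h
      rwa [← conjInv_mul, mul_inv_cancel, conjInv_one] at this
    rw [extend, extend, if_neg hX', if_neg hX]

/-- The value at `X` of the parabolic induction of `f ⊗ g`: the sum of `extend f g (s⁻¹ X s)` over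
representatives `s` of the left cosets of the parabolic subgroup. -/
def indValue {F : Type u} [Field F] [Fintype F] {i j : ℕ} (f : Mat F i → ℝ) (g : Mat F j → ℝ)
    (X : Mat F (i + j)) : ℝ :=
  letI : Fintype (GL (Fin (i + j)) F ⧸ parabolic F i j) := Fintype.ofFinite _
  ∑ s : GL (Fin (i + j)) F ⧸ parabolic F i j, extend f g (conjInv (Quotient.out s) X)

theorem indValue_mem {F : Type u} [Field F] [Fintype F] {i j : ℕ} (f : invFun F i)
    (g : invFun F j) : indValue f.1 g.1 ∈ invFun F (i + j) := by
  intro h X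
  let _ : Fintype (GL (Fin (i + j)) F ⧸ parabolic F i j) := Fintype.ofFinite _
  have hh : (h : Mat F (i + j)) * X * ((h⁻¹ : GL (Fin (i + j)) F) : Mat F (i + j))
      = conjInv h⁻¹ X := by simp [conjInv]
  rw [hh]
  unfold indValue
  refine Fintype.sum_equiv (MulAction.toPerm h⁻¹) _ _ fun s => ?_
  have hs : ((h⁻¹ * Quotient.out s : GL (Fin (i + j)) F) : GL (Fin (i + j)) F ⧸ parabolic F i j)
      = (Quotient.out (h⁻¹ • s) : GL (Fin (i + j)) F) := by
    rw [QuotientGroup.out_eq']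
    conv_rhs => rw [← QuotientGroup.out_eq' s]
    rfl
  have hmem := QuotientGroup.eq.mp hs
  rw [MulAction.toPerm_apply, ← conjInv_mul, ← extend_conjInv f g hmem, ← conjInv_mul,
    mul_inv_cancel_left]

/-- Parabolic induction, as a bilinear map. -/
def parInd (F : Type u) [Field F] [Fintype F] (i j : ℕ) :
    invFun F i →ₗ[ℝ] invFun F j →ₗ[ℝ] invFun F (i + j) :=
  LinearMap.mk₂ ℝ (fun f g => ⟨indValue f.1 g.1, indValue_mem f g⟩)
    (fun f f' g => by
      ext X
      simp only [indValue, extend, Submodule.coe_add, Pi.add_apply, ← Finset.sum_add_distrib]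
      exact Finset.sum_congr rfl fun s _ => by split_ifs <;> ring)
    (fun c f g => by
      ext X
      simp only [indValue, extend, Submodule.coe_smul, Pi.smul_apply, smul_eq_mul, Finset.mul_sum]
      exact Finset.sum_congr rfl fun s _ => by split_ifs <;> ring)
    (fun f g g' => by
      ext X
      simp only [indValue, extend, Submodule.coe_add, Pi.add_apply, ← Finset.sum_add_distrib]
      exact Finset.sum_congr rfl fun s _ => by split_ifs <;> ring)
    (fun c f g => by
      ext X
      simp only [indValue, extend, Submodule.coe_smul, Pi.smul_apply, smul_eq_mul, Finset.mul_sum]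
      exact Finset.sum_congr rfl fun s _ => by split_ifs <;> ring)

/-! ### The graded space `A_q` and the cones of functionals -/

/-- The graded space `A_q`, the direct sum of the spaces of invariant functions. -/
abbrev A (F : Type u) [Field F] : Type u := ⨁ n : ℕ, invFun F n

/-- The multiplication `∇ : A_q ⊗ A_q → A_q`, given on the component of bidegree `(i, j)` by parabolic
induction. -/
def nabla (F : Type u) [Field F] [Fintype F] : A F ⊗[ℝ] A F →ₗ[ℝ] A F :=
  TensorProduct.lift
    (DirectSum.toModule ℝ ℕ (A F →ₗ[ℝ] A F) fun i =>
      LinearMap.flip (DirectSum.toModule ℝ ℕ (invFun F i →ₗ[ℝ] A F) fun j =>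
        LinearMap.flip
          ((parInd F i j).compr₂ (DirectSum.lof ℝ ℕ (fun n => invFun F n) (i + j)))))

open Classical in
/-- The indicator function of an orbit, as an invariant function. -/
def chi {F : Type u} [Field F] {n : ℕ} (l : Orbit F n) : invFun F n :=
  ⟨fun X => if ConjClasses.mk X = l then 1 else 0, fun g X => by
    have : ConjClasses.mk ((g : Mat F n) * X * ((g⁻¹ : GL (Fin n) F) : Mat F n))
        = ConjClasses.mk X :=
      (ConjClasses.mk_eq_mk_iff_isConj.mpr ⟨g, by simp [SemiconjBy, Matrix.mul_assoc]⟩).symm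
    simp only [this]⟩

/-- The indicator function of an orbit, as an element of `A_q`. -/
def chiA {F : Type u} [Field F] {n : ℕ} (l : Orbit F n) : A F :=
  DirectSum.lof ℝ ℕ (fun n => invFun F n) n (chi l)

/-- The element `x_1`, the indicator function of the `1 × 1` zero matrix. -/
def xOne (F : Type u) [Field F] : A F := chiA (ConjClasses.mk (0 : Mat F 1))

/-- The cone `F(A_q)` of linear functionals that are nonnegative on the orbit indicators and
satisfy `φ(a) = φ(∇(x_1 ⊗ a))`. -/
def FCone (F : Type u) [Field F] [Fintype F] : PointedCone ℝ (A F →ₗ[ℝ] ℝ) where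
  carrier := {φ | (∀ (n : ℕ) (l : Orbit F n), 0 ≤ φ (chiA l)) ∧
    ∀ a : A F, φ a = φ (nabla F (xOne F ⊗ₜ[ℝ] a))}
  add_mem' := by
    rintro φ ψ ⟨h1, h2⟩ ⟨k1, k2⟩
    exact ⟨fun n l => add_nonneg (h1 n l) (k1 n l), fun a => by
      rw [LinearMap.add_apply, LinearMap.add_apply, ← h2, ← k2]⟩
  zero_mem' := ⟨fun _ _ => le_rfl, fun _ => rfl⟩
  smul_mem' := by
    rintro c φ ⟨h1, h2⟩
    exact ⟨fun n l => mul_nonneg c.2 (h1 n l), fun a => congrArg (fun y => (c : ℝ) * y) (h2 a)⟩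

/-- The subcone `F_0(A_q)` of the functionals in `F(A_q)` that vanish on the indicators of all
orbits that are not nilpotent. -/
def FConeZero (F : Type u) [Field F] [Fintype F] : PointedCone ℝ (A F →ₗ[ℝ] ℝ) :=
  FCone F ⊓
  { carrier := {φ | ∀ (n : ℕ) (l : Orbit F n), ¬ IsNilpotentOrbit l → φ (chiA l) = 0}
    add_mem' := fun h k n l hl => by rw [LinearMap.add_apply, h n l hl, k n l hl, add_zero]
    zero_mem' := fun _ _ _ => rfl
    smul_mem' := fun c φ h n l hl => by
      change (c : ℝ) * φ (chiA l) = 0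
      rw [h n l hl, mul_zero] }

end

end GLBHarmonic

/-! All the isomorphisms are changes of normalization; the content lies in matching the edge
weights. Write `q` for the number of elements of `F`.

Functionals. A function `f` on the orbits yields the functional that sends `g` of degree `n` to `N_n
∑_X g(X) f([Xᵀ])`, and every functional arises so, since orbit indicators span. Induction of `x_1 ⊗
g` sums, over the cosets of `P_{1,n}`, the conjugates of a function supported on the matrices `[0 y;
0 B]`. Since `f` is a class function all cosets contribute equally, and `N_n / N_{n+1}` is chosen to
be their number. Transposing and moving the first index to the end turns `[0 y; 0 B]` into `[Bᵀ y; 0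
0]`, so invariance under `x_1` becomes the harmonicity equation at the orbit of `Bᵀ`
(`functional_mem_FCone_iff`). A bordered matrix is nilpotent exactly when its corner is, so
extension by zero preserves harmonicity, which gives the nilpotent version.

The Young graph. Nilpotent orbits correspond to partitions through the ranks of powers. Let `X` have
Jordan type `μ`, with conjugate parts `μ'_k` and multiplicities `m_k`. Bordering `X` by `x` adds a
box to a row of length `c`, where `c ≤ k` means that `X^k x` lies in the image of `X^(k+1)`. This is
a subspace of codimension `μ'_{k+1}`, so `q^(n - μ'_{c+1})` times `1 - q^(-m_c)` vectors give the
row length `c`, without the second factor for `c = 0` (`HasType.card_borderRow_eq`). The second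
factor is the Pieri coefficient `ψ` at `t = 1/q` (`hallLittlewoodQ_pieri`, `psi_eq`), and the power
of `q` is a coboundary: it is the ratio of the values of `q^(n(λ) - (n choose 2))` at the ends of
the edge (`pow_mul_gauge_addBox`).

The Pieri formula comes from pairing permutations that differ by an adjacent transposition in the
symmetrized sum. As `psi` is an arbitrary choice of expansion coefficients, linear independence of
the `Q_λ` is also needed; it follows from the growth of the sums along a curve on which distinct
partitions have distinct leading exponents. -/

namespace GLBHarmonic

noncomputable section

universe v

/-! ### Partitions: the conjugate partition and adding a box -/

/-- The `k`-th part of the conjugate partition: the number of parts that are at least `k`. -/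
def conjPart {n : ℕ} (l : n.Partition) (k : ℕ) : ℕ := l.parts.countP (k ≤ ·)

/-- In a weakly decreasing list the entries that are at least `k` form an initial segment. The case
`k = 0` is excluded because of the default value `0` beyond the end. -/
theorem lt_countP_iff_le_getD (k : ℕ) (hk : 1 ≤ k) (L : List ℕ) (hL : L.Pairwise (· ≥ ·)) (i : ℕ) :
    i < L.countP (k ≤ ·) ↔ k ≤ L.getD i 0 := by
  induction L generalizing i with
  | nil => simp; omega
  | cons a L ih =>
    rw [List.pairwise_cons] at hL
    rw [List.countP_cons]
    by_cases ha : k ≤ a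
    · cases i with
      | zero => simp [ha]
      | succ i => simpa [ha] using ih hL.2 i
    · have h0 : L.countP (k ≤ ·) = 0 := by
        rw [List.countP_eq_zero]
        intro b hb
        have := hL.1 b hb
        simp only [decide_eq_true_eq]
        omega
      cases i with
      | zero => simp [ha, h0]
      | succ i => simpa [ha, h0] using ih hL.2 i

/-- Both sides say that the diagram has a box in row `i` (from `0`) and column `k` (from `1`). This
is the dictionary through which parts are computed from conjugate parts. -/
theorem le_part_iff {n : ℕ} (l : n.Partition) {k : ℕ} (hk : 1 ≤ k) (i : ℕ) :
    k ≤ part l i ↔ i < conjPart l k := by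
  unfold part conjPart
  rw [← lt_countP_iff_le_getD k hk _ (Multiset.pairwise_sort l.parts (· ≥ ·)) i]
  conv_rhs => rw [← Multiset.sort_eq l.parts (· ≥ ·), Multiset.coe_countP]

theorem conjPart_antitone {n : ℕ} (l : n.Partition) : Antitone (conjPart l) := fun _ _ h => by
  rw [conjPart, conjPart, Multiset.countP_eq_card_filter, Multiset.countP_eq_card_filter]
  exact Multiset.card_le_card (Multiset.monotone_filter_right _ fun _ hc => h.trans hc)

theorem conjPart_le_len {n : ℕ} (l : n.Partition) (k : ℕ) : conjPart l k ≤ len l :=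
  Multiset.countP_le_card _ _

theorem conjPart_one {n : ℕ} (l : n.Partition) : conjPart l 1 = len l :=
  Multiset.countP_eq_card.2 fun _ ha => l.parts_pos ha

theorem conjPart_eq_add_mult {n : ℕ} (l : n.Partition) (k : ℕ) :
    conjPart l k = conjPart l (k + 1) + mult l k := by
  unfold conjPart mult
  induction l.parts using Multiset.induction_on with
  | empty => simp
  | cons a s ih =>
    rw [Multiset.countP_cons, Multiset.countP_cons, Multiset.count_cons, ih]
    split_ifs <;> omega

theorem conjPart_eq_zero {n : ℕ} (l : n.Partition) {k : ℕ} (hk : n < k) : conjPart l k = 0 := by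
  rw [conjPart, Multiset.countP_eq_zero]
  intro a ha
  have := l.le_of_mem_parts ha
  omega

theorem mult_zero {n : ℕ} (l : n.Partition) : mult l 0 = 0 :=
  Multiset.count_eq_zero.2 fun h => (l.parts_pos h).ne rfl

theorem mem_parts_iff_mult {n : ℕ} (l : n.Partition) (j : ℕ) : j ∈ l.parts ↔ 0 < mult l j :=
  Multiset.count_pos.symm

theorem partition_ext_mult {n : ℕ} {l m : n.Partition} (h : ∀ j, mult l j = mult m j) : l = m :=
  Nat.Partition.ext (Multiset.ext.2 h)

theorem partition_ext_conjPart {n : ℕ} {l m : n.Partition}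
    (h : ∀ k, 1 ≤ k → conjPart l k = conjPart m k) : l = m := by
  refine partition_ext_mult fun j => ?_
  rcases Nat.eq_zero_or_pos j with rfl | hj
  · rw [mult_zero, mult_zero]
  · have := conjPart_eq_add_mult l j
    have := conjPart_eq_add_mult m j
    have := h j hj
    have := h (j + 1) (by omega)
    omega

theorem part_le {n : ℕ} (l : n.Partition) (i : ℕ) : part l i ≤ n := by
  by_contra h
  have := (le_part_iff l (k := n + 1) (by omega) i).1 (by omega)
  rw [conjPart_eq_zero l (by omega)] at this
  omega

/-- `c` is the length of a row (possibly empty) to which a box can be added. -/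
def IsRow {n : ℕ} (m : n.Partition) (c : ℕ) : Prop := c = 0 ∨ 0 < mult m c

theorem IsRow.le {n : ℕ} {m : n.Partition} {c : ℕ} (h : IsRow m c) : c ≤ n := by
  rcases h with rfl | h
  · omega
  · exact m.le_of_mem_parts ((mem_parts_iff_mult m c).2 h)

theorem IsRow.lt_conjPart {n : ℕ} {m : n.Partition} {c : ℕ} (h : IsRow m c) (hc : c ≠ 0) :
    conjPart m (c + 1) < conjPart m c := by
  have := h.resolve_left hc
  have := conjPart_eq_add_mult m c
  omega

open Classical in
/-- The partition obtained from `m` by adding a box to the first row of length `c`, if there is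
such a row. -/
def addBox {n : ℕ} (m : n.Partition) (c : ℕ) : (n + 1).Partition :=
  if h : IsRow m c then
    { parts := (c + 1) ::ₘ m.parts.erase c
      parts_pos := by
        intro i hi
        rcases Multiset.mem_cons.1 hi with rfl | hi
        · omega
        · exact m.parts_pos (Multiset.mem_of_mem_erase hi)
      parts_sum := by
        rw [Multiset.sum_cons]
        rcases h with rfl | h
        · rw [Multiset.erase_of_notMem fun h => (m.parts_pos h).ne rfl, m.parts_sum]
          omega
        · have := Multiset.sum_erase ((mem_parts_iff_mult m c).2 h)
          rw [m.parts_sum] at this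
          omega }
  -- An arbitrary value: in the sums over all `c ≤ n` below it is multiplied by a vanishing
  -- coefficient.
  else Nat.Partition.indiscrete (n + 1)

theorem addBox_parts {n : ℕ} {m : n.Partition} {c : ℕ} (h : IsRow m c) :
    (addBox m c).parts = (c + 1) ::ₘ m.parts.erase c := by
  rw [addBox, dif_pos h]

theorem conjPart_addBox {n : ℕ} {m : n.Partition} {c : ℕ} (h : IsRow m c) {k : ℕ} (hk : 1 ≤ k) :
    conjPart (addBox m c) k = conjPart m k + if k = c + 1 then 1 else 0 := by
  unfold conjPart
  rw [addBox_parts h, Multiset.countP_cons]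
  rcases h with rfl | h
  · rw [Multiset.erase_of_notMem fun h => (m.parts_pos h).ne rfl]
    split_ifs <;> omega
  · conv_rhs => rw [← Multiset.cons_erase ((mem_parts_iff_mult m c).2 h), Multiset.countP_cons]
    split_ifs <;> omega

/-- The rows longer than `c` come first, so with indices from `0` their number is the index of the
first row of length `c`, which is where the new box goes. -/
theorem part_conjPart_succ {n : ℕ} {m : n.Partition} {c : ℕ} (h : IsRow m c) :
    part m (conjPart m (c + 1)) = c := by
  have h1 := (le_part_iff m (k := c + 1) (by omega) (conjPart m (c + 1))).not.2 (lt_irrefl _)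
  rcases Nat.eq_zero_or_pos c with hc | hc
  · omega
  · have h2 := (le_part_iff m hc (conjPart m (c + 1))).2 (h.lt_conjPart hc.ne')
    omega

theorem part_addBox {n : ℕ} {m : n.Partition} {c : ℕ} (h : IsRow m c) (i : ℕ) :
    part (addBox m c) i = part m i + if i = conjPart m (c + 1) then 1 else 0 := by
  refine eq_of_forall_le_iff fun k => ?_
  rcases Nat.eq_zero_or_pos k with rfl | hk
  · simp
  rw [le_part_iff _ hk, conjPart_addBox h hk]
  split_ifs with h1 h2 h2
  · subst h1
    rw [h2, part_conjPart_succ h]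
    omega
  · subst h1
    rw [add_zero, le_part_iff _ hk]
    omega
  · rw [h2, part_conjPart_succ h]
    rcases Nat.lt_or_ge c k with hck | hck
    · have := conjPart_antitone m (show c + 1 ≤ k by omega)
      omega
    · have := conjPart_antitone m hck
      have := h.lt_conjPart (by omega)
      omega
  · rw [add_zero, add_zero, le_part_iff _ hk]

theorem diagramLE_addBox {n : ℕ} {m : n.Partition} {c : ℕ} (h : IsRow m c) :
    DiagramLE m (addBox m c) := fun i => by
  rw [part_addBox h]
  omega

theorem len_addBox {n : ℕ} {m : n.Partition} {c : ℕ} (h : IsRow m c) :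
    len (addBox m c) = len m + if c = 0 then 1 else 0 := by
  rw [← conjPart_one, conjPart_addBox h le_rfl, conjPart_one]
  simp

theorem sum_mult_eq_len {n : ℕ} (m : n.Partition) : ∑ j ∈ Finset.Icc 1 n, mult m j = len m :=
  Multiset.sum_count_eq_card fun _ ha =>
    Finset.mem_Icc.2 ⟨m.parts_pos ha, m.le_of_mem_parts ha⟩

/-- Every partition of a positive integer is obtained by adding a box. -/
theorem exists_addBox_eq {n : ℕ} (l : (n + 1).Partition) :
    ∃ (m : n.Partition) (c : ℕ), IsRow m c ∧ addBox m c = l := by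
  obtain ⟨p, hp⟩ : ∃ p, p ∈ l.parts := by
    refine Multiset.exists_mem_of_ne_zero fun h => ?_
    have := l.parts_sum
    simp [h] at this
  have hp0 := l.parts_pos hp
  have hs := Multiset.sum_erase hp
  rw [l.parts_sum] at hs
  obtain ⟨c, rfl⟩ : ∃ c, p = c + 1 := ⟨p - 1, by omega⟩
  rcases Nat.eq_zero_or_pos c with rfl | hc
  · refine ⟨⟨l.parts.erase 1, fun hi => l.parts_pos (Multiset.mem_of_mem_erase hi), by
      simp only [zero_add] at hs; omega⟩, 0, Or.inl rfl, ?_⟩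
    ext1
    rw [addBox_parts (Or.inl rfl), Multiset.erase_of_notMem, Multiset.cons_erase hp]
    exact fun h => (l.parts_pos (Multiset.mem_of_mem_erase h)).ne rfl
  · let m : n.Partition := ⟨c ::ₘ l.parts.erase (c + 1), fun {i} hi => by
      rcases Multiset.mem_cons.1 hi with rfl | hi
      · exact hc
      · exact l.parts_pos (Multiset.mem_of_mem_erase hi), by rw [Multiset.sum_cons]; omega⟩
    have hm : IsRow m c := Or.inr ((mem_parts_iff_mult m c).1 (Multiset.mem_cons_self _ _))
    refine ⟨m, c, hm, ?_⟩
    ext1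
    rw [addBox_parts hm, Multiset.erase_cons_head, Multiset.cons_erase hp]

/-! ### Symmetrized sums and multiplication by the first power sum -/

section Symmetrization

variable {K : Type*} [Field K] {N : ℕ}

/-- The kernel `∏_{i<j} (y_i - t y_j) / (y_i - y_j)` with the variables permuted by `w`. -/
def hlKernel (t : K) (y : Fin N → K) (w : Equiv.Perm (Fin N)) : K :=
  ∏ i, ∏ j ∈ Finset.Ioi i, (y (w i) - t * y (w j)) / (y (w i) - y (w j))

/-- The sum over all permutations of the variables of `y^a ∏_{i<j} (y_i - t y_j) / (y_i - y_j)`. -/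
def hlSum (t : K) (y : Fin N → K) (a : Fin N → ℕ) : K :=
  ∑ w : Equiv.Perm (Fin N), (∏ i, y (w i) ^ a i) * hlKernel t y w

/-- The sum `hlSum` with one more factor `y_k`. -/
def hlSumMul (t : K) (y : Fin N → K) (a : Fin N → ℕ) (k : Fin N) : K :=
  ∑ w : Equiv.Perm (Fin N), y (w k) * (∏ i, y (w i) ^ a i) * hlKernel t y w

theorem hlSumMul_eq (t : K) (y : Fin N → K) (a b : Fin N → ℕ) (k : Fin N)
    (h : ∀ i, b i = a i + if i = k then 1 else 0) : hlSumMul t y a k = hlSum t y b := by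
  refine Finset.sum_congr rfl fun w _ => ?_
  have : ∏ i, y (w i) ^ b i = (∏ i, y (w i) ^ a i) * ∏ i, if i = k then y (w i) else 1 := by
    rw [← Finset.prod_mul_distrib]
    refine Finset.prod_congr rfl fun i _ => ?_
    rw [h i]
    split_ifs <;> simp [pow_succ]
  rw [this, Finset.prod_ite_eq' Finset.univ k fun i => y (w i), if_pos (Finset.mem_univ k)]
  ring

/-- The power sum is symmetric, so in the term of each `w` it may be written in the permuted
variables. -/
theorem sum_mul_hlSum (t : K) (y : Fin N → K) (a : Fin N → ℕ) :
    (∑ i, y i) * hlSum t y a = ∑ k, hlSumMul t y a k := by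
  simp only [hlSum, hlSumMul]
  rw [Finset.sum_comm, Finset.mul_sum]
  refine Finset.sum_congr rfl fun w _ => ?_
  rw [← Equiv.sum_comp w y, ← Finset.sum_mul, ← Finset.sum_mul, mul_assoc]

/-- The part of the kernel outside of the pair `(k, k')`. -/
def hlKernelRest (t : K) (y : Fin N → K) (k k' : Fin N) (w : Equiv.Perm (Fin N)) : K :=
  ∏ p ∈ (Finset.univ.filter fun p : Fin N × Fin N => p.1 < p.2).erase (k, k'),
    (y (w p.1) - t * y (w p.2)) / (y (w p.1) - y (w p.2))

theorem hlKernel_eq_mul_rest (t : K) (y : Fin N → K) {k k' : Fin N} (h : k < k')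
    (w : Equiv.Perm (Fin N)) :
    hlKernel t y w = (y (w k) - t * y (w k')) / (y (w k) - y (w k')) * hlKernelRest t y k k' w := by
  unfold hlKernelRest
  rw [Finset.mul_prod_erase (Finset.univ.filter fun p : Fin N × Fin N => p.1 < p.2)
    (fun p => (y (w p.1) - t * y (w p.2)) / (y (w p.1) - y (w p.2))) (a := (k, k')) (by simpa using h),
    Finset.prod_filter, ← Finset.univ_product_univ, Finset.prod_product]
  refine Finset.prod_congr rfl fun i _ => ?_
  rw [← Finset.prod_filter]
  exact Finset.prod_congr (by ext; simp) fun _ _ => rfl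

/-- An adjacent transposition reverses the order of the pair `(k, k')` only, hence permutes the
remaining pairs `i < j` among themselves. -/
theorem hlKernelRest_mul_swap (t : K) (y : Fin N → K) {k k' : Fin N} (h : (k' : ℕ) = k + 1)
    (w : Equiv.Perm (Fin N)) :
    hlKernelRest t y k k' (w * Equiv.swap k k') = hlKernelRest t y k k' w := by
  have key : ∀ p ∈ (Finset.univ.filter fun p : Fin N × Fin N => p.1 < p.2).erase (k, k'),
      (Equiv.swap k k' p.1, Equiv.swap k k' p.2) ∈
        (Finset.univ.filter fun p : Fin N × Fin N => p.1 < p.2).erase (k, k') := by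
    rintro ⟨a, b⟩ hp
    simp only [Finset.mem_erase, Finset.mem_filter, Finset.mem_univ, true_and, ne_eq,
      Prod.mk.injEq, Equiv.swap_apply_def, Fin.lt_def, Fin.ext_iff] at hp ⊢
    split_ifs <;> omega
  refine Finset.prod_nbij' (fun p => (Equiv.swap k k' p.1, Equiv.swap k k' p.2))
    (fun p => (Equiv.swap k k' p.1, Equiv.swap k k' p.2)) key key ?_ ?_ ?_
  · simp
  · simp
  · simp

/-- Pair `w` with `w * swap k k'`: the monomial and the rest of the kernel agree. With `u`, `v` the
variables in positions `k`, `k'`, the remaining factors are `u (u - t v)/(u - v) + v (v - t u)/(v -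
u) = u + v` on one side and `v (u - t v)/(u - v) + u (v - t u)/(v - u) = t (u + v)` on the other. -/
theorem hlSumMul_succ [CharZero K] (t : K) {y : Fin N → K} (hy : Function.Injective y)
    (a : Fin N → ℕ) {k k' : Fin N} (h : (k' : ℕ) = k + 1) (ha : a k = a k') :
    hlSumMul t y a k' = t * hlSumMul t y a k := by
  have hlt : k < k' := by rw [Fin.lt_def]; omega
  have hmon : ∀ w : Equiv.Perm (Fin N),
      ∏ i, y ((w * Equiv.swap k k') i) ^ a i = ∏ i, y (w i) ^ a i := by
    intro w
    rw [← Equiv.prod_comp (Equiv.swap k k') fun i => y (w i) ^ a i]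
    refine Finset.prod_congr rfl fun i _ => ?_
    have : a (Equiv.swap k k' i) = a i := by
      rw [Equiv.swap_apply_def]
      split_ifs with h1 h2
      · rw [h1, ha]
      · rw [h2, ha]
      · rfl
    rw [this, Equiv.Perm.mul_apply]
  -- Summing over all `w` counts each pair twice; the factor `2` is cancelled at the end, which
  -- characteristic zero allows.
  have hdouble : ∀ j, 2 * hlSumMul t y a j = ∑ w : Equiv.Perm (Fin N),
      (y (w j) * (∏ i, y (w i) ^ a i) * hlKernel t y w +
        y ((w * Equiv.swap k k') j) * (∏ i, y (w i) ^ a i) *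
          hlKernel t y (w * Equiv.swap k k')) := by
    intro j
    rw [Finset.sum_add_distrib, two_mul]
    congr 1
    unfold hlSumMul
    rw [← Equiv.sum_comp (Equiv.mulRight (Equiv.swap k k'))]
    refine Finset.sum_congr rfl fun w _ => ?_
    rw [Equiv.coe_mulRight, hmon]
  refine mul_left_cancel₀ (two_ne_zero (α := K)) ?_
  rw [mul_left_comm, hdouble, hdouble, Finset.mul_sum]
  refine Finset.sum_congr rfl fun w _ => ?_
  rw [hlKernel_eq_mul_rest t y hlt, hlKernel_eq_mul_rest t y hlt, hlKernelRest_mul_swap t y h]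
  simp only [Equiv.Perm.mul_apply, Equiv.swap_apply_left, Equiv.swap_apply_right]
  have h1 : y (w k) - y (w k') ≠ 0 := sub_ne_zero.2 fun e => hlt.ne (w.injective (hy e))
  have h2 : y (w k') - y (w k) ≠ 0 := sub_ne_zero.2 fun e => hlt.ne' (w.injective (hy e))
  have h3 : y (w k') - y (w k) = -(y (w k) - y (w k')) := by ring
  rw [h3, div_neg]
  field_simp
  ring

/-- Along a run of equal exponents the sums `hlSumMul` form a geometric progression. -/
theorem hlSumMul_add [CharZero K] (t : K) {y : Fin N → K} (hy : Function.Injective y)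
    (a : ℕ → ℕ) (k d : ℕ) (h : k + d < N) (ha : ∀ i, k ≤ i → i ≤ k + d → a i = a k) :
    hlSumMul t y (fun i => a i) ⟨k + d, h⟩
      = t ^ d * hlSumMul t y (fun i => a i) ⟨k, by omega⟩ := by
  induction d with
  | zero => simp
  | succ d ih =>
    rw [hlSumMul_succ t hy (fun i => a i) (k := ⟨k + d, by omega⟩) (by simp; omega),
      ih (by omega) fun i h1 h2 => ha i h1 (by omega), pow_succ']
    · ring
    · exact (ha (k + d) (by omega) (by omega)).trans
        (ha (k + (d + 1)) (by omega) (by omega)).symm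

theorem filter_part_eq {n : ℕ} (m : n.Partition) (hN : len m ≤ N) (c : ℕ) :
    (Finset.range N).filter (fun i => part m i = c) =
      Finset.Ico (conjPart m (c + 1)) (if c = 0 then N else conjPart m c) := by
  ext i
  rw [Finset.mem_filter, Finset.mem_range, Finset.mem_Ico]
  have h1 := le_part_iff m (k := c + 1) (by omega) i
  split_ifs with hc
  · omega
  · have h2 := le_part_iff m (k := c) (by omega) i
    have := conjPart_le_len m c
    omega

/-- The number of rows of length `c`, when the partition is regarded as having `N` rows. -/
def rowCount (N : ℕ) {n : ℕ} (m : n.Partition) (c : ℕ) : ℕ :=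
  if c = 0 then N - len m else mult m c

/-- The rows of equal length `c` are consecutive. Raising the exponent of the first of them gives
the sum for `addBox m c`, and the others contribute successive powers of `t`; the geometric series
produces the coefficient. -/
theorem sum_mul_hlSum_part [CharZero K] (t : K) (ht : t ≠ 1) {y : Fin N → K}
    (hy : Function.Injective y) {n : ℕ} (m : n.Partition) (hN : len m ≤ N) :
    (∑ i, y i) * hlSum t y (fun i => part m i) =
      ∑ c ∈ Finset.range (n + 1), (1 - t ^ rowCount N m c) / (1 - t) *
        hlSum t y (fun i => part (addBox m c) i) := by
  let g : ℕ → K := fun i => if h : i < N then hlSumMul t y (fun i => part m i) ⟨i, h⟩ else 0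
  have hg : ∑ k, hlSumMul t y (fun i => part m i) k = ∑ i ∈ Finset.range N, g i := by
    rw [Finset.sum_range]
    exact Finset.sum_congr rfl fun i _ => by simp [g]
  rw [sum_mul_hlSum, hg, ← Finset.sum_fiberwise_of_maps_to (t := Finset.range (n + 1))
    (g := fun i => part m i) fun i _ => by have := part_le m i; simp; omega]
  refine Finset.sum_congr rfl fun c _ => ?_
  rw [filter_part_eq m hN, Finset.sum_Ico_eq_sum_range]
  have hlen : (if c = 0 then N else conjPart m c) - conjPart m (c + 1) = rowCount N m c := by
    unfold rowCount
    split_ifs with hc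
    · rw [hc, zero_add, conjPart_one]
    · rw [conjPart_eq_add_mult m c]
      omega
  rw [hlen]
  rcases Nat.eq_zero_or_pos (rowCount N m c) with h0 | h0
  · simp [h0]
  have hrow : IsRow m c := by
    unfold rowCount at h0
    split_ifs at h0 with hc
    · exact Or.inl hc
    · exact Or.inr h0
  have hbound : conjPart m (c + 1) + rowCount N m c ≤ N := by
    rw [← hlen]
    have := conjPart_le_len m (c + 1)
    have := conjPart_le_len m c
    split_ifs <;> omega
  have hgeom : ∀ d ∈ Finset.range (rowCount N m c), g (conjPart m (c + 1) + d) =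
      t ^ d * hlSum t y (fun i => part (addBox m c) i) := by
    intro d hd
    rw [Finset.mem_range] at hd
    have hlt : conjPart m (c + 1) + d < N := by omega
    simp only [g]
    rw [dif_pos hlt, hlSumMul_add t hy (part m) (conjPart m (c + 1)) d hlt]
    · rw [hlSumMul_eq t y (fun i => part m i) (fun i => part (addBox m c) i)]
      intro i
      simp only [part_addBox hrow, Fin.ext_iff]
    · intro i h1 h2
      rw [part_conjPart_succ hrow]
      have : i ∈ (Finset.range N).filter (fun i => part m i = c) := by
        rw [filter_part_eq m hN, Finset.mem_Ico]
        omega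
      exact (Finset.mem_filter.1 this).2
  rw [Finset.sum_congr rfl hgeom, ← Finset.sum_mul, geom_sum_eq ht, ← neg_div_neg_eq, neg_sub,
    neg_sub]

end Symmetrization

/-! ### The Pieri formula for the functions `Q` -/

theorem one_sub_pow_ne_zero {t : ℝ} (h0 : 0 < t) (h1 : t < 1) {i : ℕ} (hi : i ≠ 0) :
    1 - t ^ i ≠ 0 :=
  (sub_pos.2 (pow_lt_one₀ h0.le h1 hi)).ne'

theorem vfac_ne_zero {t : ℝ} (h0 : 0 < t) (h1 : t < 1) (m : ℕ) : vfac t m ≠ 0 :=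
  Finset.prod_ne_zero_iff.2 fun i hi => div_ne_zero
    (one_sub_pow_ne_zero h0 h1 (by have := (Finset.mem_Icc.1 hi).1; omega)) (by linarith)

theorem phi_eq {t : ℝ} (h1 : t < 1) (m : ℕ) : phi t m = (1 - t) ^ m * vfac t m := by
  have : (1 - t) ^ m = ∏ i ∈ Finset.Icc 1 m, (1 - t) := by simp
  rw [phi, vfac, this, ← Finset.prod_mul_distrib]
  refine Finset.prod_congr rfl fun i _ => ?_
  rw [mul_div_cancel₀]
  linarith

theorem vfac_succ (t : ℝ) (m : ℕ) : vfac t (m + 1) = vfac t m * ((1 - t ^ (m + 1)) / (1 - t)) :=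
  Finset.prod_Icc_succ_top (by omega) _

theorem var_injective (N : ℕ) : Function.Injective (var : Fin N → RatFun N) := fun _ _ h =>
  MvPolynomial.X_injective (IsFractionRing.injective (MvPolynomial (Fin N) ℝ) (RatFun N) h)

theorem hallLittlewoodP_eq (t : ℝ) {n : ℕ} (l : n.Partition) (N : ℕ) :
    hallLittlewoodP t l N =
      (vfac t (N - len l) * ∏ j ∈ Finset.Icc 1 n, vfac t (mult l j))⁻¹ •
        hlSum (algebraMap ℝ (RatFun N) t) var (fun i => part l i) := by
  simp only [hallLittlewoodP, hlSum, hlKernel, Algebra.smul_def]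

/-- Since `φ_m = (1 - t)^m v_m`, the factor `b_l` cancels the normalization of `P_l` for the nonzero
parts; only the power of `1 - t` and the factor `v` of the zero parts survive. -/
theorem hallLittlewoodQ_eq {t : ℝ} (h0 : 0 < t) (h1 : t < 1) {n : ℕ} (l : n.Partition) {N : ℕ}
    (hN : len l ≤ N) :
    hallLittlewoodQ t l N = ((1 - t) ^ len l / vfac t (N - len l)) •
      hlSum (algebraMap ℝ (RatFun N) t) var (fun i => part l i) := by
  have h : ∏ j ∈ Finset.Icc 1 n, phi t (mult l j) =
      (1 - t) ^ len l * ∏ j ∈ Finset.Icc 1 n, vfac t (mult l j) := by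
    rw [← sum_mult_eq_len, ← Finset.prod_pow_eq_pow_sum, ← Finset.prod_mul_distrib]
    exact Finset.prod_congr rfl fun j _ => phi_eq h1 _
  have hv : ∏ j ∈ Finset.Icc 1 n, vfac t (mult l j) ≠ 0 :=
    Finset.prod_ne_zero_iff.2 fun j _ => vfac_ne_zero h0 h1 _
  rw [hallLittlewoodQ, if_pos hN, hallLittlewoodP_eq, smul_smul, h]
  congr 1
  field_simp

/-- The coefficient of the Pieri formula for adding a box to a row of length `c`. -/
def pieriCoeff (t : ℝ) {n : ℕ} (m : n.Partition) (c : ℕ) : ℝ :=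
  if c = 0 then 1 else 1 - t ^ mult m c

theorem isRow_of_pieriCoeff_ne_zero {t : ℝ} {n : ℕ} {m : n.Partition} {c : ℕ}
    (h : pieriCoeff t m c ≠ 0) : IsRow m c := by
  unfold pieriCoeff at h
  split_ifs at h with hc
  · exact Or.inl hc
  · refine Or.inr (Nat.pos_of_ne_zero fun h' => h ?_)
    rw [h', pow_zero, sub_self]

/-- For `c ≠ 0` the length is unchanged and `1 - t` cancels the denominator of the geometric series.
For `c = 0` the factor `1 - t^(N - len m)` is absorbed by the `v` of the zero parts, so the
coefficient does not depend on the number `N` of variables. -/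
theorem hallLittlewoodQ_pieri {t : ℝ} (h0 : 0 < t) (h1 : t < 1) {n : ℕ} (m : n.Partition) :
    ((1 - t) • powerSumOne) * hallLittlewoodQ t m =
      ∑ c ∈ Finset.range (n + 1), pieriCoeff t m c • hallLittlewoodQ t (addBox m c) := by
  funext N
  rw [Pi.mul_apply, Pi.smul_apply, Finset.sum_apply]
  simp only [Pi.smul_apply]
  by_cases hN : len m ≤ N
  · have ht : algebraMap ℝ (RatFun N) t ≠ 1 := fun h =>
      h1.ne ((algebraMap ℝ (RatFun N)).injective (h.trans (map_one _).symm))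
    have key := sum_mul_hlSum_part (algebraMap ℝ (RatFun N) t) ht (var_injective N) m hN
    rw [hallLittlewoodQ_eq h0 h1 m hN, smul_mul_smul_comm, powerSumOne, key, Finset.smul_sum]
    refine Finset.sum_congr rfl fun c _ => ?_
    have hcast : (1 - algebraMap ℝ (RatFun N) t ^ rowCount N m c) / (1 - algebraMap ℝ (RatFun N) t)
        = algebraMap ℝ (RatFun N) ((1 - t ^ rowCount N m c) / (1 - t)) := by
      simp only [map_div₀, map_sub, map_one, map_pow]
    rw [hcast, ← Algebra.smul_def, smul_smul]
    have h1t : 1 - t ≠ 0 := by linarith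
    by_cases hrow : IsRow m c
    · have hlen := len_addBox hrow
      by_cases hc : c = 0
      · rw [if_pos hc] at hlen
        rw [pieriCoeff, if_pos hc, rowCount, if_pos hc, one_smul]
        by_cases hN' : len m + 1 ≤ N
        · rw [hallLittlewoodQ_eq h0 h1 _ (by omega), hlen]
          congr 1
          obtain ⟨d, hd⟩ : ∃ d, N - len m = d + 1 := ⟨N - len m - 1, by omega⟩
          rw [hd, vfac_succ, show N - (len m + 1) = d by omega]
          have := vfac_ne_zero h0 h1 d
          have := one_sub_pow_ne_zero h0 h1 (Nat.succ_ne_zero d)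
          field_simp
          ring
        -- With exactly `len m` variables there is no empty row, and `Q` of the longer partition is
        -- zero by definition.
        · rw [show N - len m = 0 by omega, hallLittlewoodQ, if_neg (by omega)]
          simp
      · rw [if_neg hc, add_zero] at hlen
        rw [pieriCoeff, if_neg hc, rowCount, if_neg hc, hallLittlewoodQ_eq h0 h1 _ (by omega),
          smul_smul, hlen]
        congr 1
        field_simp
    · have h2 : c ≠ 0 := fun h => hrow (Or.inl h)
      have h3 : mult m c = 0 := by
        by_contra h
        exact hrow (Or.inr (Nat.pos_of_ne_zero h))
      rw [pieriCoeff, if_neg h2, rowCount, if_neg h2, h3]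
      simp
  · rw [hallLittlewoodQ, if_neg hN, mul_zero]
    refine (Finset.sum_eq_zero fun c _ => ?_).symm
    by_cases hc : pieriCoeff t m c = 0
    · rw [hc, zero_smul]
    · have := len_addBox (isRow_of_pieriCoeff_ne_zero hc)
      rw [hallLittlewoodQ, if_neg (by omega), smul_zero]

/-! ### Linear independence of the functions `Q` -/

section Independence

open Filter Topology

/-- The polynomial obtained from `hlSum` by clearing denominators. -/
def hlPoly (t : ℝ) {N : ℕ} (a : Fin N → ℕ) : MvPolynomial (Fin N) ℝ :=
  ∑ w : Equiv.Perm (Fin N), (∏ i, MvPolynomial.X (w i) ^ a i) *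
    ∏ i, ∏ j ∈ Finset.Ioi i, (MvPolynomial.X (w i) - MvPolynomial.C t * MvPolynomial.X (w j)) *
      (MvPolynomial.X (w j) - MvPolynomial.X (w i))

/-- The product runs over all ordered pairs of distinct indices, hence is symmetric. It can
therefore serve as a common denominator for all terms of `hlSum`. -/
theorem prod_sub_mul_sub_perm {R : Type*} [CommRing R] {N : ℕ} (y : Fin N → R)
    (w : Equiv.Perm (Fin N)) :
    ∏ i, ∏ j ∈ Finset.Ioi i, (y (w i) - y (w j)) * (y (w j) - y (w i)) =
      ∏ i, ∏ j ∈ Finset.Ioi i, (y i - y j) * (y j - y i) := by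
  have h := fun z : Fin N → R =>
    Finset.prod_prod_Ioi_mul_eq_prod_prod_off_diag (fun i j => z j - z i)
  rw [h fun i => y (w i), h y]
  conv_rhs => rw [← Equiv.prod_comp w]
  refine Finset.prod_congr rfl fun i _ => ?_
  refine Finset.prod_nbij' w w.symm ?_ ?_ ?_ ?_ ?_ <;> simp [Equiv.symm_apply_eq]

theorem map_hlPoly {K : Type*} [Field K] (t : ℝ) {N : ℕ} (a : Fin N → ℕ)
    (f : MvPolynomial (Fin N) ℝ →+* K)
    (hf : Function.Injective fun i => f (MvPolynomial.X i)) :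
    f (hlPoly t a) = hlSum (f (MvPolynomial.C t)) (fun i => f (MvPolynomial.X i)) a *
      ∏ i, ∏ j ∈ Finset.Ioi i, (f (MvPolynomial.X i) - f (MvPolynomial.X j)) *
        (f (MvPolynomial.X j) - f (MvPolynomial.X i)) := by
  simp only [hlPoly, hlSum, map_sum, map_mul, map_prod, map_pow, map_sub, Finset.sum_mul]
  refine Finset.sum_congr rfl fun w _ => ?_
  rw [mul_assoc, ← prod_sub_mul_sub_perm (fun i => f (MvPolynomial.X i)) w, hlKernel]
  congr 1
  rw [← Finset.prod_mul_distrib]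
  refine Finset.prod_congr rfl fun i _ => ?_
  rw [← Finset.prod_mul_distrib]
  refine Finset.prod_congr rfl fun j hj => ?_
  have : f (MvPolynomial.X (w i)) - f (MvPolynomial.X (w j)) ≠ 0 :=
    sub_ne_zero.2 fun e => (Finset.mem_Ioi.1 hj).ne (w.injective (hf e))
  field_simp

/-- Elements of the fraction field cannot be evaluated directly. The denominators are cleared, the
resulting polynomial identity is evaluated, and the denominator is divided out again, being nonzero
at points with distinct coordinates. -/
theorem sum_hlSum_eval {ι : Type*} [Fintype ι] (t : ℝ) {N : ℕ} (a : ι → Fin N → ℕ) (d : ι → ℝ)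
    (h : ∑ l, d l • hlSum (algebraMap ℝ (RatFun N) t) var (a l) = 0) {y : Fin N → ℝ}
    (hy : Function.Injective y) : ∑ l, d l * hlSum t y (a l) = 0 := by
  let f : MvPolynomial (Fin N) ℝ →+* RatFun N := algebraMap _ _
  have hC : ∀ x : ℝ, f (MvPolynomial.C x) = algebraMap ℝ (RatFun N) x := fun x =>
    (IsScalarTower.algebraMap_apply ℝ (MvPolynomial (Fin N) ℝ) (RatFun N) x).symm
  have h1 : ∑ l, MvPolynomial.C (d l) * hlPoly t (a l) = 0 := by
    apply IsFractionRing.injective (MvPolynomial (Fin N) ℝ) (RatFun N)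
    change f _ = f 0
    have hf : Function.Injective fun i => f (MvPolynomial.X i) := var_injective N
    simp only [map_sum, map_mul, map_hlPoly t _ f hf, hC, map_zero]
    simp only [← mul_assoc]
    rw [← Finset.sum_mul]
    simp only [← Algebra.smul_def]
    exact (congrArg (· * _) h).trans (zero_mul _)
  have h2 := congrArg (MvPolynomial.eval y) h1
  have hy' : Function.Injective fun i => MvPolynomial.eval y (MvPolynomial.X i) := by
    simpa using hy
  simp only [map_sum, map_mul, map_hlPoly t _ _ hy', map_zero, MvPolynomial.eval_C,
    MvPolynomial.eval_X, ← mul_assoc] at h2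
  rw [← Finset.sum_mul] at h2
  refine (mul_eq_zero.1 h2).resolve_right ?_
  refine Finset.prod_ne_zero_iff.2 fun i _ => Finset.prod_ne_zero_iff.2 fun j hj => ?_
  have := (Finset.mem_Ioi.1 hj).ne
  exact mul_ne_zero (sub_ne_zero.2 fun e => this (hy e)) (sub_ne_zero.2 fun e => this (hy e).symm)

/-- The limit is `t` if `b < c` and `1` if `b > c`. Only its positivity matters, as it excludes
cancellation between permutations. -/
theorem exists_tendsto_ratio {t : ℝ} (h0 : 0 < t) {b c : ℕ} (hbc : b ≠ c) :
    ∃ L : ℝ, 0 < L ∧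
      Tendsto (fun r : ℝ => (r ^ b - t * r ^ c) / (r ^ b - r ^ c)) atTop (𝓝 L) := by
  have key : ∀ {b c : ℕ}, b < c → Tendsto (fun r : ℝ => r ^ b / r ^ c) atTop (𝓝 0) := by
    intro b c h
    exact tendsto_pow_div_pow_atTop_zero h
  rcases lt_or_gt_of_ne hbc with h | h
  · refine ⟨t, h0, ?_⟩
    have : Tendsto (fun r : ℝ => (r ^ b / r ^ c - t) / (r ^ b / r ^ c - 1)) atTop
        (𝓝 ((0 - t) / (0 - 1))) :=
      ((key h).sub_const t).div ((key h).sub_const 1) (by norm_num)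
    rw [show (0 - t) / (0 - 1) = t by ring] at this
    refine this.congr' ?_
    filter_upwards [eventually_gt_atTop 0] with r hr
    have hr' : r ^ c ≠ 0 := (pow_pos hr c).ne'
    rw [← mul_div_mul_right _ _ hr', sub_mul, sub_mul, div_mul_cancel₀ _ hr', one_mul]
  · refine ⟨1, one_pos, ?_⟩
    have : Tendsto (fun r : ℝ => (1 - t * (r ^ c / r ^ b)) / (1 - r ^ c / r ^ b)) atTop
        (𝓝 ((1 - t * 0) / (1 - 0))) :=
      ((((key h).const_mul t).const_sub 1)).div ((key h).const_sub 1) (by norm_num)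
    rw [show (1 - t * 0) / (1 - 0) = (1 : ℝ) by norm_num] at this
    refine this.congr' ?_
    filter_upwards [eventually_gt_atTop 0] with r hr
    have hr' : r ^ b ≠ 0 := (pow_pos hr b).ne'
    rw [← mul_div_mul_right _ _ hr', sub_mul, sub_mul, mul_assoc, div_mul_cancel₀ _ hr', one_mul]

theorem exists_tendsto_hlKernel {t : ℝ} (h0 : 0 < t) {N : ℕ} {B : Fin N → ℕ}
    (hB : Function.Injective B) (w : Equiv.Perm (Fin N)) :
    ∃ L : ℝ, 0 < L ∧ Tendsto (fun r : ℝ => hlKernel t (fun i => r ^ B i) w) atTop (𝓝 L) := by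
  have h : ∀ i j : Fin N, ∃ L : ℝ, 0 < L ∧ (j ∈ Finset.Ioi i → Tendsto (fun r : ℝ =>
      (r ^ B (w i) - t * r ^ B (w j)) / (r ^ B (w i) - r ^ B (w j))) atTop (𝓝 L)) := by
    intro i j
    by_cases hj : j ∈ Finset.Ioi i
    · obtain ⟨L, hL, hL'⟩ := exists_tendsto_ratio h0 (b := B (w i)) (c := B (w j))
        fun e => (Finset.mem_Ioi.1 hj).ne (w.injective (hB e))
      exact ⟨L, hL, fun _ => hL'⟩
    · exact ⟨1, one_pos, fun h => absurd h hj⟩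
  choose L hL hL' using h
  exact ⟨∏ i, ∏ j ∈ Finset.Ioi i, L i j, Finset.prod_pos fun i _ => Finset.prod_pos fun j _ => hL i j,
    tendsto_finsetProd _ fun i _ => tendsto_finsetProd _ fun j hj => hL' i j hj⟩

theorem card_filter_le_part {n N : ℕ} (l : n.Partition) (hN : len l ≤ N)
    (σ : Equiv.Perm (Fin N)) {k : ℕ} (hk : 1 ≤ k) :
    (Finset.univ.filter fun i => k ≤ part l (σ i)).card = conjPart l k := by
  rw [Finset.card_filter, Equiv.sum_comp σ fun i : Fin N => if k ≤ part l i then 1 else 0,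
    Fin.sum_univ_eq_sum_range (fun i => if k ≤ part l i then 1 else 0) N, ← Finset.card_filter]
  have : (Finset.range N).filter (fun i => k ≤ part l i) = Finset.range (conjPart l k) := by
    ext i
    rw [Finset.mem_filter, Finset.mem_range, Finset.mem_range, le_part_iff l hk]
    have := conjPart_le_len l k
    omega
  rw [this, Finset.card_range]

theorem len_le {n : ℕ} (l : n.Partition) : len l ≤ n := by
  have h : l.parts.card • 1 ≤ l.parts.sum := Multiset.card_nsmul_le_sum fun i hi => l.parts_pos hi
  rw [l.parts_sum, smul_eq_mul, mul_one] at h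
  exact h

/-- The parts are at most `n`, so they are the digits of the sum in base `n + 1`, in an order given
by the permutation. The digits determine the multiset of parts. -/
theorem eq_of_weighted_sum_eq {n : ℕ} {l l' : n.Partition} {w w' : Equiv.Perm (Fin n)}
    (h : ∑ i : Fin n, (n + 1) ^ (w i : ℕ) * part l i = ∑ i, (n + 1) ^ (w' i : ℕ) * part l' i) :
    l = l' := by
  have key : ∀ (l : n.Partition) (w : Equiv.Perm (Fin n)),
      ∑ i : Fin n, (n + 1) ^ (w i : ℕ) * part l i =
        finFunctionFinEquiv fun i =>
          (⟨part l (w.symm i), Nat.lt_succ_of_le (part_le l _)⟩ : Fin (n + 1)) := by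
    intro l w
    rw [finFunctionFinEquiv_apply]
    conv_rhs => rw [← Equiv.sum_comp w]
    exact Finset.sum_congr rfl fun i _ => by simp [mul_comm]
  rw [key, key] at h
  have h' := congrFun (finFunctionFinEquiv.injective (Fin.ext h))
  refine partition_ext_conjPart fun k hk => ?_
  rw [← card_filter_le_part l (len_le l) w.symm hk, ← card_filter_le_part l' (len_le l') w'.symm hk]
  congr 1
  ext i
  have := Fin.ext_iff.1 (h' i)
  simp only at this
  simp [this]

/-- Substitute `y_i = r^((n + 1)^i)` and divide by the largest power of `r` that occurs with a
nonzero coefficient. As `r` tends to infinity only the partition `l₀` with this exponent survives,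
and its limit is `d l₀` times a positive number. -/
theorem hlSum_independent {t : ℝ} (h0 : 0 < t) {n : ℕ} (d : n.Partition → ℝ)
    (h : ∀ y : Fin n → ℝ, Function.Injective y →
      ∑ l, d l * hlSum t y (fun i => part l i) = 0) : d = 0 := by
  classical
  by_contra hd
  obtain ⟨l₁, hl₁⟩ : ∃ l, d l ≠ 0 := by
    by_contra! h'
    exact hd (funext h')
  let B : Fin n → ℕ := fun i => (n + 1) ^ (i : ℕ)
  have hB : Function.Injective B := fun i j hij =>
    Fin.ext (Nat.pow_right_injective (by have := i.2; omega) hij)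
  let e : n.Partition × Equiv.Perm (Fin n) → ℕ := fun p => ∑ i : Fin n, B (p.2 i) * part p.1 i
  obtain ⟨⟨l₀, w₀⟩, hp, hmax⟩ := Finset.exists_max_image
    (Finset.univ.filter fun p : n.Partition × Equiv.Perm (Fin n) => d p.1 ≠ 0) e
    ⟨(l₁, 1), by simpa using hl₁⟩
  have hl₀ : d l₀ ≠ 0 := by simpa using hp
  have hmax' : ∀ l w, d l ≠ 0 → e (l, w) ≤ e (l₀, w₀) := fun l w hl =>
    hmax (l, w) (by simpa using hl)
  choose L hL hL' using fun w => exists_tendsto_hlKernel h0 hB w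
  have hlim : Tendsto (fun r : ℝ => ∑ l, ∑ w : Equiv.Perm (Fin n),
      d l * (r ^ e (l, w) / r ^ e (l₀, w₀)) * hlKernel t (fun i => r ^ B i) w) atTop
      (𝓝 (∑ l, ∑ w : Equiv.Perm (Fin n),
        d l * (if e (l, w) = e (l₀, w₀) then 1 else 0) * L w)) := by
    refine tendsto_finsetSum _ fun l _ => tendsto_finsetSum _ fun w _ => ?_
    by_cases hl : d l = 0
    · simp [hl]
    · refine Tendsto.mul (Tendsto.const_mul _ ?_) (hL' w)
      split_ifs with he
      · rw [he]
        refine tendsto_const_nhds.congr' ?_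
        filter_upwards [eventually_gt_atTop 0] with r hr
        rw [div_self (pow_pos hr _).ne']
      · exact tendsto_pow_div_pow_atTop_zero (lt_of_le_of_ne (hmax' l w hl) he)
  have hzero : Tendsto (fun r : ℝ => ∑ l, ∑ w : Equiv.Perm (Fin n),
      d l * (r ^ e (l, w) / r ^ e (l₀, w₀)) * hlKernel t (fun i => r ^ B i) w) atTop (𝓝 0) := by
    refine tendsto_const_nhds.congr' ?_
    filter_upwards [eventually_gt_atTop 1] with r hr
    have hy : Function.Injective fun i => r ^ B i := fun i j hij =>
      hB (pow_right_injective₀ (by linarith) hr.ne' hij)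
    have h' := congrArg (· / r ^ e (l₀, w₀)) (h _ hy)
    simp only [zero_div, Finset.sum_div] at h'
    rw [← h']
    refine Finset.sum_congr rfl fun l _ => ?_
    rw [hlSum, Finset.mul_sum, Finset.sum_div]
    refine Finset.sum_congr rfl fun w _ => ?_
    have : r ^ e (l, w) = ∏ i, (r ^ B (w i)) ^ part l i := by
      simp only [e, ← Finset.prod_pow_eq_pow_sum, pow_mul]
    rw [this]
    ring
  have hs := tendsto_nhds_unique hlim hzero
  rw [Finset.sum_eq_single l₀, Finset.sum_congr rfl fun w _ => mul_assoc _ _ _,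
    ← Finset.mul_sum] at hs
  · refine hl₀ ((mul_eq_zero.1 hs).resolve_right (ne_of_gt ?_))
    refine Finset.sum_pos' (fun w _ => ?_) ⟨w₀, Finset.mem_univ _, ?_⟩
    · exact mul_nonneg (by split_ifs <;> norm_num) (hL w).le
    · rw [if_pos rfl, one_mul]
      exact hL w₀
  · intro l _ hl
    refine Finset.sum_eq_zero fun w _ => ?_
    rw [if_neg fun he => hl (eq_of_weighted_sum_eq he), mul_zero, zero_mul]
  · simp

/-- It is enough to look at `n` variables: every partition of `n` has length at most `n`, so no `Q`
is cut off. -/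
theorem hallLittlewoodQ_independent {t : ℝ} (h0 : 0 < t) (h1 : t < 1) {n : ℕ}
    {c c' : n.Partition → ℝ}
    (h : ∑ l, c l • hallLittlewoodQ t l = ∑ l, c' l • hallLittlewoodQ t l) : c = c' := by
  have h2 : ∑ l : n.Partition, (c l - c' l) • hallLittlewoodQ t l n = 0 := by
    have := congrFun h n
    simp only [Finset.sum_apply, Pi.smul_apply] at this
    simp only [sub_smul, Finset.sum_sub_distrib, this, sub_self]
  simp only [hallLittlewoodQ_eq h0 h1 _ (len_le _), smul_smul] at h2
  have h3 := hlSum_independent h0 _ fun y hy => sum_hlSum_eval t _ _ h2 hy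
  funext l
  have h4 := congrFun h3 l
  have h5 : (1 - t) ^ len l / vfac t (n - len l) ≠ 0 :=
    div_ne_zero (pow_ne_zero _ (by linarith)) (vfac_ne_zero h0 h1 _)
  exact sub_eq_zero.1 ((mul_eq_zero.1 h4).resolve_right h5)

-- Independence forces the chosen coefficients to be those of the Pieri formula. The sum over `c`
-- avoids having to recover `c` from `l`.
open Classical in
theorem psi_eq {t : ℝ} (h0 : 0 < t) (h1 : t < 1) {n : ℕ} (m : n.Partition) :
    psi t m = fun l => ∑ c ∈ Finset.range (n + 1), if addBox m c = l then pieriCoeff t m c else 0 := by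
  have h : ((1 - t) • powerSumOne) * hallLittlewoodQ t m = ∑ l : (n + 1).Partition,
      (∑ c ∈ Finset.range (n + 1), if addBox m c = l then pieriCoeff t m c else 0) •
        hallLittlewoodQ t l := by
    rw [hallLittlewoodQ_pieri h0 h1]
    simp only [Finset.sum_smul, ite_smul, zero_smul]
    rw [Finset.sum_comm]
    simp
  have hex : ∃ c : (n + 1).Partition → ℝ,
      ((1 - t) • powerSumOne) * hallLittlewoodQ t m = ∑ l, c l • hallLittlewoodQ t l := ⟨_, h⟩
  rw [psi, dif_pos hex]
  exact hallLittlewoodQ_independent h0 h1 (hex.choose_spec.symm.trans h)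

/-- The edge condition removes nothing: a nonzero coefficient occurs only for `l = addBox m c` with
`c` a row length of `m`, and this diagram contains that of `m`. -/
theorem sum_hlYoungGraph_weight {t : ℝ} (h0 : 0 < t) (h1 : t < 1) {n : ℕ} (m : n.Partition)
    (f : (n + 1).Partition → ℝ) :
    ∑ l : (n + 1).Partition, (hlYoungGraph t).weight n l m * f l =
      ∑ c ∈ Finset.range (n + 1), pieriCoeff t m c * f (addBox m c) := by
  classical
  have : ∀ l : (n + 1).Partition, (hlYoungGraph t).weight n l m * f l =
      ∑ c ∈ Finset.range (n + 1), if addBox m c = l then pieriCoeff t m c * f l else 0 := by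
    intro l
    change (if DiagramLE m l then psi t m l else 0) * f l = _
    rw [psi_eq h0 h1]
    split_ifs with hl
    · simp only [Finset.sum_mul, ite_mul, zero_mul]
    · rw [zero_mul]
      refine (Finset.sum_eq_zero fun c _ => ?_).symm
      split_ifs with he
      · by_cases hc : pieriCoeff t m c = 0
        · rw [hc, zero_mul]
        · exact absurd (he ▸ diagramLE_addBox (isRow_of_pieriCoeff_ne_zero hc)) hl
      · rfl
  rw [Finset.sum_congr rfl fun l _ => this l, Finset.sum_comm]
  simp

end Independence

/-! ### Classification of nilpotent matrices -/

section Classification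

open Polynomial

variable {F : Type u} [Field F]

/-- The cyclic module `F[X] / (X^k)`. -/
abbrev CyclicModule (F : Type u) [Field F] (k : ℕ) : Type u :=
  F[X] ⧸ Submodule.span F[X] {(X ^ k : F[X])}

theorem natCard_quotient_span_X_pow (k : ℕ) :
    Nat.card (F[X] ⧸ Ideal.span {(X ^ k : F[X])}) = Nat.card F ^ k := by
  have hm : (X ^ k : F[X]).Monic := monic_X_pow k
  have := hm.free_quotient
  have := hm.finite_quotient
  rw [Module.natCard_eq_pow_finrank (K := F), finrank_quotient_span_eq_natDegree, natDegree_X_pow]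

theorem smul_mk_cyclicModule_eq_zero_iff (k : ℕ) (r p : F[X]) :
    r • (Submodule.Quotient.mk p : CyclicModule F k) = 0 ↔ X ^ k ∣ r * p := by
  rw [← Submodule.Quotient.mk_smul, Submodule.Quotient.mk_eq_zero]
  exact Ideal.mem_span_singleton

/-- If `k ≤ m` everything is torsion. If `k = a + m`, the torsion is the image of multiplication by
`X^a`, a copy of `F[X] / (X^m)`. -/
theorem natCard_torsion_cyclicModule (k m : ℕ) :
    Nat.card {x : CyclicModule F k // (X ^ m : F[X]) • x = 0} = Nat.card F ^ min k m := by
  rcases le_total k m with h | h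
  · have htop : ∀ x : CyclicModule F k, (X ^ m : F[X]) • x = 0 := by
      intro x
      obtain ⟨p, rfl⟩ := Submodule.Quotient.mk_surjective _ x
      rw [smul_mk_cyclicModule_eq_zero_iff]
      exact (pow_dvd_pow X h).trans (dvd_mul_right _ p)
    rw [min_eq_left h, ← natCard_quotient_span_X_pow k]
    exact Nat.card_congr (Equiv.subtypeUnivEquiv htop)
  · obtain ⟨a, rfl⟩ := Nat.exists_eq_add_of_le' h
    let g : F[X] →ₗ[F[X]] CyclicModule F (a + m) :=
      (LinearMap.lsmul F[X] (CyclicModule F (a + m)) (X ^ a : F[X])).comp (Submodule.mkQ _)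
    have hX : (X : F[X]) ^ a ≠ 0 := pow_ne_zero _ X_ne_zero
    have hg : ∀ p, g p = (X ^ a : F[X]) • (Submodule.Quotient.mk p : CyclicModule F (a + m)) :=
      fun p => rfl
    have hker : LinearMap.ker g = Ideal.span {(X ^ m : F[X])} := by
      ext p
      rw [LinearMap.mem_ker, hg, smul_mk_cyclicModule_eq_zero_iff, Ideal.mem_span_singleton,
        pow_add]
      exact mul_dvd_mul_iff_left hX
    have hrange : ∀ x : CyclicModule F (a + m), x ∈ LinearMap.range g ↔ (X ^ m : F[X]) • x = 0 := by
      intro x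
      constructor
      · rintro ⟨p, rfl⟩
        rw [hg, smul_smul, smul_mk_cyclicModule_eq_zero_iff, ← pow_add, add_comm]
        exact dvd_mul_right _ _
      · intro hx
        obtain ⟨p, rfl⟩ := Submodule.Quotient.mk_surjective _ x
        rw [smul_mk_cyclicModule_eq_zero_iff, add_comm, pow_add] at hx
        obtain ⟨r, hr⟩ := (mul_dvd_mul_iff_left (pow_ne_zero m X_ne_zero)).1 hx
        refine ⟨r, ?_⟩
        rw [hg, hr, ← Submodule.Quotient.mk_smul, smul_eq_mul]
    rw [min_eq_right h, ← natCard_quotient_span_X_pow m, ← hker,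
      Nat.card_congr g.quotKerEquivRange.toEquiv]
    exact Nat.card_congr (Equiv.subtypeEquivRight fun x => (hrange x).symm)

theorem natCard_ker_pow_mulVec [Finite F] {n : ℕ} (X : Mat F n) :
    Nat.card {v : Fin n → F // X.mulVec v = 0} * Nat.card F ^ X.rank = Nat.card F ^ n := by
  have h := LinearMap.finrank_range_add_finrank_ker X.mulVecLin
  rw [Module.finrank_fin_fun] at h
  have h2 : Nat.card {v : Fin n → F // X.mulVec v = 0} =
      Nat.card F ^ Module.finrank F (LinearMap.ker X.mulVecLin) := by
    rw [← Module.natCard_eq_pow_finrank]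
    exact Nat.card_congr (Equiv.subtypeEquivRight fun v => by simp)
  rw [h2, ← pow_add, add_comm, Matrix.rank, h]

theorem mulVecLin_pow_apply {n : ℕ} (X : Mat F n) (k : ℕ) (v : Fin n → F) :
    (X.mulVecLin ^ k) v = (X ^ k).mulVec v := by
  induction k generalizing v with
  | zero => simp
  | succ k ih => rw [pow_succ, Module.End.mul_apply, ih, pow_succ, ← Matrix.mulVec_mulVec]; rfl

/-- A nilpotent matrix decomposes into cyclic blocks. -/
theorem exists_cyclic_decomposition [Finite F] {n : ℕ} {A : Mat F n} (hA : IsNilpotent A) :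
    ∃ (d : ℕ) (k : Fin d → ℕ),
      Nonempty (Module.AEval' A.mulVecLin ≃ₗ[F[X]] ∀ i, CyclicModule F (k i)) ∧
      ∀ m, (A ^ m).rank + ∑ i, min (k i) m = n := by
  classical
  obtain ⟨N, hN⟩ := hA
  have htors : Module.IsTorsion' (Module.AEval' A.mulVecLin) (Submonoid.powers (X : F[X])) := by
    rw [Submodule.isTorsion'_powers_iff]
    intro x
    obtain ⟨v, rfl⟩ := (Module.AEval'.of A.mulVecLin).surjective x
    refine ⟨N, ?_⟩
    rw [Module.AEval'.X_pow_smul_of, Module.End.smul_def, mulVecLin_pow_apply, hN,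
      Matrix.zero_mulVec, map_zero]
  obtain ⟨d, k, ⟨e⟩⟩ := Module.torsion_by_prime_power_decomposition irreducible_X htors
  let e' := e.trans (DirectSum.linearEquivFunOnFintype F[X] (Fin d) fun i => CyclicModule F (k i))
  refine ⟨d, k, ⟨e'⟩, fun m => ?_⟩
  -- The kernel of `A^m` is the `X^m`-torsion, counted factor by factor; comparison with
  -- rank-nullity then yields the rank.
  have h1 : Nat.card {v : Fin n → F // (A ^ m).mulVec v = 0} =
      Nat.card F ^ ∑ i, min (k i) m := by
    rw [← Finset.prod_pow_eq_pow_sum,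
      ← Finset.prod_congr rfl fun i _ => natCard_torsion_cyclicModule (k i) m, ← Nat.card_pi,
      ← Nat.card_congr (Equiv.subtypePiEquivPi (p := fun i (x : CyclicModule F (k i)) =>
        (X ^ m : F[X]) • x = 0))]
    refine Nat.card_congr (((Module.AEval'.of A.mulVecLin).toEquiv.trans e'.toEquiv).subtypeEquiv
      fun v => ?_)
    rw [← mulVecLin_pow_apply]
    change _ ↔ ∀ i, (X ^ m : F[X]) • (e' (Module.AEval'.of A.mulVecLin v)) i = 0
    rw [← Module.End.smul_def, ← (Module.AEval'.of A.mulVecLin).map_eq_zero_iff,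
      ← Module.AEval'.X_pow_smul_of, ← e'.map_eq_zero_iff, map_smul, funext_iff]
    rfl
  have h2 := natCard_ker_pow_mulVec (A ^ m)
  rw [h1, ← pow_add] at h2
  have := Nat.pow_right_injective Finite.one_lt_card h2
  omega

/-- Linearity over `F[X]` means that the underlying linear isomorphism intertwines `A` and `B`; its
matrix conjugates one into the other. -/
theorem isConj_of_aeval_equiv {n : ℕ} {A B : Mat F n}
    (e : Module.AEval' A.mulVecLin ≃ₗ[F[X]] Module.AEval' B.mulVecLin) : IsConj A B := by
  let f : (Fin n → F) ≃ₗ[F] (Fin n → F) :=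
    (Module.AEval'.of A.mulVecLin).trans
      ((e.restrictScalars F).trans (Module.AEval'.of B.mulVecLin).symm)
  have hf : ∀ v, f (A.mulVecLin v) = B.mulVecLin (f v) := by
    intro v
    simp only [f, LinearEquiv.trans_apply, LinearEquiv.restrictScalars_apply]
    rw [← Module.AEval'.X_smul_of, map_smul, Module.AEval'.of_symm_X_smul]
  have h12 : ∀ g g' : (Fin n → F) ≃ₗ[F] (Fin n → F), (∀ v, g (g' v) = v) →
      LinearMap.toMatrix' g.toLinearMap * LinearMap.toMatrix' g'.toLinearMap = 1 := by
    intro g g' h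
    rw [← LinearMap.toMatrix'_comp, ← LinearMap.toMatrix'_id]
    congr 1
    ext1 v
    exact LinearMap.ext fun x => h _
  refine ⟨⟨LinearMap.toMatrix' f.toLinearMap, LinearMap.toMatrix' f.symm.toLinearMap,
    h12 _ _ f.apply_symm_apply, h12 _ _ f.symm_apply_apply⟩, ?_⟩
  change LinearMap.toMatrix' f.toLinearMap * A = B * LinearMap.toMatrix' f.toLinearMap
  rw [← LinearMap.toMatrix'_toLin' A, ← LinearMap.toMatrix'_toLin' B, ← LinearMap.toMatrix'_comp,
    ← LinearMap.toMatrix'_comp]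
  congr 1
  exact LinearMap.ext fun v => hf v

theorem subsingleton_cyclicModule_zero : Subsingleton (CyclicModule F 0) := by
  rw [Submodule.Quotient.subsingleton_iff, pow_zero]
  exact Ideal.span_singleton_one

/-- A product of cyclic modules is isomorphic to the subproduct of the nontrivial factors. -/
def piCyclicEquivNonzero {ι : Type*} (k : ι → ℕ) :
    (∀ i, CyclicModule F (k i)) ≃ₗ[F[X]] ∀ i : {i // k i ≠ 0}, CyclicModule F (k i) :=
  LinearEquiv.ofBijective (LinearMap.pi fun i : {i // k i ≠ 0} => LinearMap.proj i.1) <| by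
    have hsub : ∀ i, k i = 0 → Subsingleton (CyclicModule F (k i)) := fun i hi =>
      hi ▸ subsingleton_cyclicModule_zero
    constructor
    · intro x y hxy
      funext i
      by_cases hi : k i = 0
      · exact (hsub i hi).elim _ _
      · exact congrFun hxy ⟨i, hi⟩
    · intro y
      classical
      refine ⟨fun i => if hi : k i ≠ 0 then y ⟨i, hi⟩ else 0, funext fun i => ?_⟩
      exact dif_pos i.2

/-- The structure theorem used here may return exponents `0`, whose factors are trivial. They are
discarded first, so only multiplicities of positive exponents are compared. -/
theorem nonempty_piCyclic_equiv {ι ι' : Type*} [Fintype ι] [Fintype ι'] (k : ι → ℕ) (k' : ι' → ℕ)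
    (h : ∀ j, j ≠ 0 → (Finset.univ.filter fun i => k i = j).card =
      (Finset.univ.filter fun i => k' i = j).card) :
    Nonempty ((∀ i, CyclicModule F (k i)) ≃ₗ[F[X]] ∀ i, CyclicModule F (k' i)) := by
  classical
  have hfib : ∀ j, Nonempty ({i : {i // k i ≠ 0} // k i = j} ≃ {i : {i // k' i ≠ 0} // k' i = j}) := by
    intro j
    by_cases hj : j = 0
    · have h1 : IsEmpty {i : {i // k i ≠ 0} // k i = j} := ⟨fun i => i.1.2 (i.2.trans hj)⟩
      have h2 : IsEmpty {i : {i // k' i ≠ 0} // k' i = j} := ⟨fun i => i.1.2 (i.2.trans hj)⟩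
      exact ⟨Equiv.equivOfIsEmpty _ _⟩
    · have h0 := h j hj
      rw [← Fintype.card_subtype, ← Fintype.card_subtype] at h0
      have e0 := Fintype.equivOfCardEq h0
      have e1 : {i : {i // k i ≠ 0} // k i = j} ≃ {i // k i = j} :=
        Equiv.subtypeSubtypeEquivSubtype (p := fun i => k i ≠ 0) (q := fun i => k i = j)
          fun {i} hi => hi.symm ▸ hj
      have e2 : {i : {i // k' i ≠ 0} // k' i = j} ≃ {i // k' i = j} :=
        Equiv.subtypeSubtypeEquivSubtype (p := fun i => k' i ≠ 0) (q := fun i => k' i = j)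
          fun {i} hi => hi.symm ▸ hj
      exact ⟨e1.trans (e0.trans e2.symm)⟩
  let σ : {i // k i ≠ 0} ≃ {i // k' i ≠ 0} :=
    Equiv.ofFiberEquiv (f := fun i => k i) (g := fun i => k' i) fun j => (hfib j).some
  have hσ : ∀ i, k' (σ i) = k i := fun i =>
    Equiv.ofFiberEquiv_map (f := fun i : {i // k i ≠ 0} => k i)
      (g := fun i : {i // k' i ≠ 0} => k' i) (fun j => (hfib j).some) i
  let e1 : (∀ i : {i // k i ≠ 0}, CyclicModule F (k i)) ≃ₗ[F[X]]
      ∀ i : {i // k i ≠ 0}, CyclicModule F (k' (σ i)) :=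
    LinearEquiv.piCongrRight fun i => Submodule.quotEquivOfEq _ _ (by rw [hσ i])
  let e2 : (∀ i : {i // k i ≠ 0}, CyclicModule F (k' (σ i))) ≃ₗ[F[X]]
      ∀ i : {i // k' i ≠ 0}, CyclicModule F (k' i) :=
    LinearEquiv.piCongrLeft F[X] (fun i : {i // k' i ≠ 0} => CyclicModule F (k' i)) σ
  exact ⟨(piCyclicEquivNonzero k).trans (e1.trans (e2.trans (piCyclicEquivNonzero k').symm))⟩

theorem sum_min_succ {ι : Type*} [Fintype ι] (k : ι → ℕ) (m : ℕ) :
    ∑ i, min (k i) (m + 1) = ∑ i, min (k i) m + (Finset.univ.filter fun i => m + 1 ≤ k i).card := by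
  rw [Finset.card_filter, ← Finset.sum_add_distrib]
  exact Finset.sum_congr rfl fun i _ => by split_ifs <;> omega

theorem card_filter_le_eq {ι : Type*} [Fintype ι] (k : ι → ℕ) (m : ℕ) :
    (Finset.univ.filter fun i => m ≤ k i).card =
      (Finset.univ.filter fun i => m + 1 ≤ k i).card + (Finset.univ.filter fun i => k i = m).card := by
  simp only [Finset.card_filter, ← Finset.sum_add_distrib]
  exact Finset.sum_congr rfl fun i _ => by split_ifs <;> omega

/-- Nilpotent matrices whose powers have the same ranks are conjugate. -/
theorem isConj_of_rank_pow_eq [Finite F] {n : ℕ} {A B : Mat F n} (hA : IsNilpotent A)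
    (hB : IsNilpotent B) (h : ∀ m, (A ^ m).rank = (B ^ m).rank) : IsConj A B := by
  obtain ⟨d, k, ⟨e⟩, hk⟩ := exists_cyclic_decomposition hA
  obtain ⟨d', k', ⟨e'⟩, hk'⟩ := exists_cyclic_decomposition hB
  have hge : ∀ m, (Finset.univ.filter fun i => m + 1 ≤ k i).card =
      (Finset.univ.filter fun i => m + 1 ≤ k' i).card := by
    intro m
    have := hk m
    have := hk (m + 1)
    have := hk' m
    have := hk' (m + 1)
    have := sum_min_succ k m
    have := sum_min_succ k' m
    have := h m
    have := h (m + 1)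
    omega
  obtain ⟨e''⟩ := nonempty_piCyclic_equiv (F := F) k k' fun j hj => by
    obtain ⟨m, rfl⟩ := Nat.exists_eq_succ_of_ne_zero hj
    have := card_filter_le_eq k (m + 1)
    have := card_filter_le_eq k' (m + 1)
    have := hge m
    have := hge (m + 1)
    simp only [Nat.succ_eq_add_one]
    omega
  exact isConj_of_aeval_equiv (e.trans (e''.trans e'.symm))

/-! ### Jordan types of nilpotent matrices -/

/-- The nilpotent matrix `A` has Jordan blocks of the sizes given by the parts of `l`. -/
def HasType {n : ℕ} (A : Mat F n) (l : n.Partition) : Prop :=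
  ∀ k, (A ^ k).rank = (l.parts.map fun p => p - k).sum

theorem exists_hasType [Finite F] {n : ℕ} {A : Mat F n} (hA : IsNilpotent A) :
    ∃ l : n.Partition, HasType A l := by
  obtain ⟨d, k, -, hk⟩ := exists_cyclic_decomposition hA
  have hsum : ∀ m, (A ^ m).rank = ∑ i, (k i - m) := by
    intro m
    obtain ⟨N, hN⟩ := hA
    -- An exponent so large that the power of `A` vanishes and every minimum is `k i`; this gives `∑
    -- k i = n`.
    have h0 := hk (N + ∑ i, k i)
    have hmin : ∑ i, min (k i) (N + ∑ i, k i) = ∑ i, k i := Finset.sum_congr rfl fun i _ =>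
      min_eq_left ((Finset.single_le_sum (f := k) (fun _ _ => Nat.zero_le _)
        (Finset.mem_univ i)).trans (Nat.le_add_left _ N))
    rw [hmin, pow_add, hN, zero_mul, Matrix.rank_zero, zero_add] at h0
    have h1 := hk m
    have h2 : ∑ i, k i = ∑ i, (k i - m) + ∑ i, min (k i) m := by
      rw [← Finset.sum_add_distrib]
      exact Finset.sum_congr rfl fun i _ => by omega
    omega
  have hn : (Finset.univ.val.map k).sum = n := by
    have := hsum 0
    rw [pow_zero, Matrix.rank_one, Fintype.card_fin] at this
    simpa [List.sum_ofFn] using this.symm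
  refine ⟨Nat.Partition.ofSums n _ hn, fun m => ?_⟩
  rw [hsum m, Nat.Partition.ofSums_parts]
  have : ∀ s : Multiset ℕ, ((s.filter fun p => p ≠ 0).map fun p => p - m).sum = (s.map fun p => p - m).sum := by
    intro s
    induction s using Multiset.induction_on with
    | empty => simp
    | cons a s ih =>
      by_cases ha : a = 0
      · rw [Multiset.filter_cons_of_neg (p := fun p => p ≠ 0) _ (by simpa using ha), Multiset.map_cons,
          Multiset.sum_cons, ih, ha, Nat.zero_sub, zero_add]
      · rw [Multiset.filter_cons_of_pos (p := fun p => p ≠ 0) _ ha, Multiset.map_cons, Multiset.map_cons,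
          Multiset.sum_cons, Multiset.sum_cons, ih]
  rw [this, Multiset.map_map]
  rfl

theorem sum_map_sub_eq {n : ℕ} (l : n.Partition) (k : ℕ) :
    (l.parts.map fun p => p - k).sum =
      (l.parts.map fun p => p - (k + 1)).sum + conjPart l (k + 1) := by
  unfold conjPart
  induction l.parts using Multiset.induction_on with
  | empty => simp
  | cons a s ih =>
    rw [Multiset.map_cons, Multiset.map_cons, Multiset.sum_cons, Multiset.sum_cons,
      Multiset.countP_cons, ih]
    split_ifs <;> omega

theorem HasType.rank_eq {n : ℕ} {A : Mat F n} {l : n.Partition} (h : HasType A l) (k : ℕ) :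
    (A ^ k).rank = (A ^ (k + 1)).rank + conjPart l (k + 1) := by
  rw [h k, h (k + 1), sum_map_sub_eq]

/-- The drop of the rank from `A^k` to `A^(k+1)` is the conjugate part of index `k + 1`. -/
theorem HasType.unique {n : ℕ} {A : Mat F n} {l l' : n.Partition} (h : HasType A l)
    (h' : HasType A l') : l = l' := by
  refine partition_ext_conjPart fun k hk => ?_
  obtain ⟨k, rfl⟩ := Nat.exists_eq_succ_of_ne_zero (Nat.one_le_iff_ne_zero.1 hk)
  have := h.rank_eq k
  have := h'.rank_eq k
  simp only [Nat.succ_eq_add_one]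
  omega

theorem HasType.isNilpotent {n : ℕ} {A : Mat F n} {l : n.Partition} (h : HasType A l) :
    IsNilpotent A := by
  refine ⟨n, ?_⟩
  have h0 : (A ^ n).rank = 0 := by
    rw [h n, Multiset.sum_eq_zero]
    intro x hx
    obtain ⟨p, hp, rfl⟩ := Multiset.mem_map.1 hx
    exact Nat.sub_eq_zero_of_le (l.le_of_mem_parts hp)
  have h1 : Matrix.toLin' (A ^ n) = 0 := LinearMap.range_eq_bot.1 (Submodule.finrank_eq_zero.1 h0)
  exact (LinearEquiv.map_eq_zero_iff _).1 h1

theorem HasType.of_isConj {n : ℕ} {A B : Mat F n} {l : n.Partition} (h : HasType A l)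
    (hAB : IsConj A B) : HasType B l := by
  obtain ⟨c, hc⟩ := hAB
  intro k
  have hu : IsUnit (c : Mat F n).det := (Matrix.isUnit_iff_isUnit_det _).1 c.isUnit
  have hk : (c : Mat F n) * A ^ k = B ^ k * c := hc.pow_right k
  rw [← h k, ← Matrix.rank_mul_eq_left_of_isUnit_det (c : Mat F n) (B ^ k) hu, ← hk,
    Matrix.rank_mul_eq_right_of_isUnit_det _ _ hu]

theorem HasType.isConj [Finite F] {n : ℕ} {A B : Mat F n} {l : n.Partition} (h : HasType A l)
    (h' : HasType B l) : IsConj A B :=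
  isConj_of_rank_pow_eq h.isNilpotent h'.isNilpotent fun m => (h m).trans (h' m).symm

end Classification

/-! ### Nilpotent bordered matrices -/

section Bordered

variable {F : Type u} [Field F] {n : ℕ}

theorem bordered_mul (X Y : Mat F n) (x y : Fin n → F) :
    bordered X x * bordered Y y = bordered (X * Y) (X.mulVec y) := by
  simp only [bordered, Matrix.reindex_apply, Matrix.submatrix_mul_equiv, Matrix.fromBlocks_multiply,
    Matrix.mul_zero, Matrix.zero_mul, add_zero]
  congr 2

theorem bordered_pow_succ (X : Mat F n) (x : Fin n → F) (k : ℕ) :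
    bordered X x ^ (k + 1) = bordered (X ^ (k + 1)) ((X ^ k).mulVec x) := by
  induction k with
  | zero => simp
  | succ k ih => rw [pow_succ', ih, bordered_mul, ← pow_succ', Matrix.mulVec_mulVec, ← pow_succ']

/-- The column space is that of `X` enlarged by `x`, embedded with last coordinate zero. -/
theorem rank_bordered (X : Mat F n) (x : Fin n → F) :
    (bordered X x).rank =
      Module.finrank F ↥(LinearMap.range X.mulVecLin ⊔ Submodule.span F {x}) := by
  rw [bordered, Matrix.rank_reindex, Matrix.rank]
  let ι : (Fin n → F) →ₗ[F] (Fin n ⊕ Fin 1 → F) :=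
    { toFun := fun v => Sum.elim v 0
      map_add' := fun v w => by ext (i | i) <;> simp
      map_smul' := fun c v => by ext (i | i) <;> simp }
  have hι : Function.Injective ι := fun v w h => funext fun i => congrFun h (Sum.inl i)
  have hrange : LinearMap.range (Matrix.fromBlocks X (Matrix.replicateCol (Fin 1) x) 0 0).mulVecLin
      = (LinearMap.range X.mulVecLin ⊔ Submodule.span F {x}).map ι := by
    ext v
    simp only [LinearMap.mem_range, Submodule.mem_map, Submodule.mem_sup,
      Submodule.mem_span_singleton, Matrix.mulVecLin_apply]
    have hcol : ∀ w : Fin 1 → F, (Matrix.replicateCol (Fin 1) x).mulVec w = w 0 • x := by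
      intro w
      ext i
      simp [Matrix.mulVec, dotProduct, mul_comm]
    constructor
    · rintro ⟨w, rfl⟩
      refine ⟨_, ⟨_, ⟨w ∘ Sum.inl, rfl⟩, _, ⟨w (Sum.inr 0), rfl⟩, rfl⟩, ?_⟩
      rw [Matrix.fromBlocks_mulVec, hcol, Matrix.zero_mulVec, Matrix.zero_mulVec, add_zero]
      rfl
    · rintro ⟨_, ⟨_, ⟨u, rfl⟩, _, ⟨a, rfl⟩, rfl⟩, rfl⟩
      refine ⟨Sum.elim u fun _ => a, ?_⟩
      rw [Matrix.fromBlocks_mulVec, hcol, Matrix.zero_mulVec, Matrix.zero_mulVec, add_zero,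
        Sum.elim_comp_inl]
      rfl
  rw [hrange]
  exact (Submodule.equivMapOfInjective ι hι _).finrank_eq.symm

/-- The vectors `x` with `X^k x` in the image of `X^(k+1)`. -/
def borderSpace (X : Mat F n) (k : ℕ) : Submodule F (Fin n → F) :=
  (LinearMap.range (X ^ (k + 1)).mulVecLin).comap (X ^ k).mulVecLin

theorem mem_borderSpace {X : Mat F n} {k : ℕ} {x : Fin n → F} :
    x ∈ borderSpace X k ↔ (X ^ k).mulVec x ∈ LinearMap.range (X ^ (k + 1)).mulVecLin :=
  Iff.rfl

open Classical in
theorem rank_bordered_pow_succ (X : Mat F n) (x : Fin n → F) (k : ℕ) :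
    (bordered X x ^ (k + 1)).rank =
      (X ^ (k + 1)).rank + if x ∈ borderSpace X k then 0 else 1 := by
  rw [bordered_pow_succ, rank_bordered]
  split_ifs with h
  · rw [sup_eq_left.2 ((Submodule.span_singleton_le_iff_mem _ _).2 (mem_borderSpace.1 h))]
    rfl
  · rw [Submodule.finrank_sup_span_singleton (mem_borderSpace.not.1 h)]
    rfl

theorem borderSpace_mono (X : Mat F n) : Monotone (borderSpace X) := by
  refine monotone_nat_of_le_succ fun k x hx => ?_
  obtain ⟨y, hy⟩ := mem_borderSpace.1 hx
  refine ⟨y, ?_⟩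
  rw [Matrix.mulVecLin_apply] at hy ⊢
  rw [Matrix.mulVecLin_apply, pow_succ', ← Matrix.mulVec_mulVec, hy, Matrix.mulVec_mulVec, ← pow_succ']

/-- `X^k` maps `borderSpace X k` onto the image of `X^(k+1)`, and the space contains the whole
kernel of `X^k`. -/
theorem finrank_borderSpace (X : Mat F n) (k : ℕ) :
    Module.finrank F (borderSpace X k) + (X ^ k).rank = n + (X ^ (k + 1)).rank := by
  have h := LinearMap.finrank_range_add_finrank_ker ((X ^ k).mulVecLin.domRestrict (borderSpace X k))
  have h1 := LinearMap.finrank_range_add_finrank_ker (X ^ k).mulVecLin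
  rw [Module.finrank_fin_fun] at h1
  have hle : LinearMap.range (X ^ (k + 1)).mulVecLin ≤ LinearMap.range (X ^ k).mulVecLin := by
    rintro _ ⟨v, rfl⟩
    exact ⟨X.mulVec v, by simp [Matrix.mulVec_mulVec, pow_succ]⟩
  have hr : LinearMap.range ((X ^ k).mulVecLin.domRestrict (borderSpace X k)) =
      LinearMap.range (X ^ (k + 1)).mulVecLin := by
    rw [LinearMap.range_domRestrict, borderSpace, Submodule.map_comap_eq, inf_eq_right.2 hle]
  have hk : Module.finrank F (LinearMap.ker ((X ^ k).mulVecLin.domRestrict (borderSpace X k))) =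
      Module.finrank F (LinearMap.ker (X ^ k).mulVecLin) := by
    rw [LinearMap.ker_domRestrict]
    refine LinearEquiv.finrank_eq (Submodule.comapSubtypeEquivOfLe fun v hv => ?_)
    rw [mem_borderSpace, ← Matrix.mulVecLin_apply, LinearMap.mem_ker.1 hv]
    exact zero_mem _
  rw [hr, hk] at h
  simp only [Matrix.rank]
  omega

theorem HasType.finrank_borderSpace {X : Mat F n} {m : n.Partition} (h : HasType X m) (k : ℕ) :
    Module.finrank F (borderSpace X k) + conjPart m (k + 1) = n := by
  have := GLBHarmonic.finrank_borderSpace X k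
  have := h.rank_eq k
  omega

theorem HasType.exists_mem_borderSpace {X : Mat F n} {m : n.Partition} (h : HasType X m)
    (x : Fin n → F) : ∃ k, x ∈ borderSpace X k := by
  obtain ⟨k, hk⟩ := h.isNilpotent
  refine ⟨k, ?_⟩
  rw [mem_borderSpace, hk, Matrix.zero_mulVec]
  exact zero_mem _

open Classical in
/-- The length of the row of the Jordan type of `X` to which a box is added by bordering with `x`. -/
def borderRow (X : Mat F n) (x : Fin n → F) : ℕ :=
  if h : ∃ k, x ∈ borderSpace X k then Nat.find h else 0

theorem HasType.borderRow_le_iff {X : Mat F n} {m : n.Partition} (h : HasType X m)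
    (x : Fin n → F) (k : ℕ) : borderRow X x ≤ k ↔ x ∈ borderSpace X k := by
  classical
  have hex := h.exists_mem_borderSpace x
  rw [borderRow, dif_pos hex, Nat.find_le_iff]
  exact ⟨fun ⟨j, hj, hx⟩ => borderSpace_mono X hj hx, fun hx => ⟨k, le_rfl, hx⟩⟩

/-- If no row has length `c + 1`, the border spaces at `c` and `c + 1` have equal dimension and
coincide, so `c + 1` cannot be the first index at which `x` enters. -/
theorem HasType.isRow_borderRow {X : Mat F n} {m : n.Partition} (h : HasType X m)
    (x : Fin n → F) : IsRow m (borderRow X x) := by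
  by_contra hrow
  unfold IsRow at hrow
  obtain ⟨c, hc⟩ : ∃ c, borderRow X x = c + 1 := Nat.exists_eq_succ_of_ne_zero (by tauto)
  rw [hc] at hrow
  have h1 := h.finrank_borderSpace c
  have h2 := h.finrank_borderSpace (c + 1)
  have h3 := conjPart_eq_add_mult m (c + 1)
  have heq : borderSpace X c = borderSpace X (c + 1) :=
    Submodule.eq_of_le_of_finrank_eq (borderSpace_mono X (Nat.le_succ c)) (by omega)
  have h4 := (h.borderRow_le_iff x (c + 1)).1 hc.le
  rw [← heq, ← h.borderRow_le_iff x c] at h4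
  omega

/-- Bordering a nilpotent matrix adds a box to its Jordan type. -/
theorem HasType.bordered {X : Mat F n} {m : n.Partition} (h : HasType X m) (x : Fin n → F) :
    HasType (bordered X x) (addBox m (borderRow X x)) := by
  classical
  have hrow := h.isRow_borderRow x
  have hsum : ∀ k, ((addBox m (borderRow X x)).parts.map fun p => p - k).sum =
      (m.parts.map fun p => p - k).sum + if k ≤ borderRow X x then 1 else 0 := by
    intro k
    rw [addBox_parts hrow, Multiset.map_cons, Multiset.sum_cons]
    rcases hrow with h0 | h0
    · rw [h0, Multiset.erase_of_notMem fun h => (m.parts_pos h).ne rfl]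
      split_ifs <;> omega
    · conv_rhs => rw [← Multiset.cons_erase ((mem_parts_iff_mult m _).2 h0), Multiset.map_cons,
        Multiset.sum_cons]
      split_ifs <;> omega
  intro k
  rw [hsum, ← h k]
  cases k with
  | zero => simp
  | succ k =>
    rw [rank_bordered_pow_succ, ← h.borderRow_le_iff]
    split_ifs <;> omega

theorem HasType.natCard_borderRow_le [Finite F] {X : Mat F n} {m : n.Partition} (h : HasType X m)
    (k : ℕ) : Nat.card {x : Fin n → F // borderRow X x ≤ k} =
      Nat.card F ^ (n - conjPart m (k + 1)) := by
  have h1 := h.finrank_borderSpace k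
  rw [show n - conjPart m (k + 1) = Module.finrank F (borderSpace X k) by omega,
    ← Module.natCard_eq_pow_finrank]
  exact Nat.card_congr (Equiv.subtypeEquivRight fun x => h.borderRow_le_iff x k)

/-- For `c > 0` this is the difference of the sizes of two consecutive border spaces, whose
codimensions differ by `mult m c`. -/
theorem HasType.card_borderRow_eq [Fintype F] {X : Mat F n} {m : n.Partition}
    (h : HasType X m) (c : ℕ) :
    ((Finset.univ.filter fun x : Fin n → F => borderRow X x = c).card : ℝ) =
      (Fintype.card F : ℝ) ^ (n - conjPart m (c + 1)) *
        pieriCoeff ((Fintype.card F : ℝ)⁻¹) m c := by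
  have hle : ∀ k, (Finset.univ.filter fun x : Fin n → F => borderRow X x ≤ k).card =
      Fintype.card F ^ (n - conjPart m (k + 1)) := by
    intro k
    rw [← Nat.card_eq_fintype_card (α := F), ← h.natCard_borderRow_le k, Nat.card_eq_fintype_card,
      Fintype.card_subtype]
  have hq : (Fintype.card F : ℝ) ≠ 0 := by exact_mod_cast Fintype.card_ne_zero
  unfold pieriCoeff
  cases c with
  | zero =>
    have := hle 0
    simp only [Nat.le_zero] at this
    rw [this, if_pos rfl, mul_one]
    push_cast
    rfl
  | succ c =>
    rw [if_neg (Nat.succ_ne_zero c)]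
    have hsplit : (Finset.univ.filter fun x : Fin n → F => borderRow X x ≤ c + 1).card =
        (Finset.univ.filter fun x : Fin n → F => borderRow X x ≤ c).card +
          (Finset.univ.filter fun x : Fin n → F => borderRow X x = c + 1).card := by
      simp only [Finset.card_filter, ← Finset.sum_add_distrib]
      exact Finset.sum_congr rfl fun x _ => by split_ifs <;> omega
    rw [hle, hle] at hsplit
    have hsplit' := congrArg (Nat.cast (R := ℝ)) hsplit
    push_cast at hsplit'
    have h1 := h.finrank_borderSpace c
    have h3 := conjPart_eq_add_mult m (c + 1)
    have hexp : n - conjPart m (c + 1 + 1) = n - conjPart m (c + 1) + mult m (c + 1) := by omega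
    rw [mul_sub, mul_one, hexp, pow_add, mul_assoc, ← mul_pow, mul_inv_cancel₀ hq, one_pow, mul_one,
      ← pow_add, ← hexp]
    linarith

theorem HasType.sum_bordered [Fintype F] {X : Mat F n} {m : n.Partition}
    (h : HasType X m) (g : (n + 1).Partition → ℝ) :
    ∑ x : Fin n → F, g (addBox m (borderRow X x)) = ∑ c ∈ Finset.range (n + 1),
      (Fintype.card F : ℝ) ^ (n - conjPart m (c + 1)) *
        pieriCoeff ((Fintype.card F : ℝ)⁻¹) m c * g (addBox m c) := by
  rw [← Finset.sum_fiberwise_of_maps_to (t := Finset.range (n + 1)) (g := fun x => borderRow X x)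
    fun x _ => Finset.mem_range.2 (Nat.lt_succ_of_le (h.isRow_borderRow x).le)]
  refine Finset.sum_congr rfl fun c _ => ?_
  rw [← h.card_borderRow_eq, ← nsmul_eq_mul, ← Finset.sum_const]
  refine Finset.sum_congr rfl fun x hx => ?_
  rw [(Finset.mem_filter.1 hx).2]

theorem pieriCoeff_pos {t : ℝ} (h0 : 0 < t) (h1 : t < 1) {m : n.Partition} {c : ℕ}
    (h : IsRow m c) : 0 < pieriCoeff t m c := by
  unfold pieriCoeff
  split_ifs with hc
  · exact one_pos
  · exact sub_pos.2 (pow_lt_one₀ h0.le h1 (h.resolve_left hc).ne')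

theorem inv_card_pos [Fintype F] : (0 : ℝ) < (Fintype.card F : ℝ)⁻¹ :=
  inv_pos.2 (by exact_mod_cast Fintype.card_pos)

theorem inv_card_lt_one [Fintype F] : (Fintype.card F : ℝ)⁻¹ < 1 :=
  inv_lt_one_of_one_lt₀ (by exact_mod_cast Fintype.one_lt_card)

/-- Every partition is the Jordan type of a nilpotent matrix. -/
theorem exists_matrix_hasType (F : Type u) [Field F] [Finite F] :
    ∀ (n : ℕ) (l : n.Partition), ∃ X : Mat F n, HasType X l := by
  classical
  have := Fintype.ofFinite F
  intro n
  induction n with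
  | zero =>
    intro l
    refine ⟨0, fun k => ?_⟩
    have h0 : l.parts = 0 := by rw [Subsingleton.elim l (Nat.Partition.indiscrete 0)]; rfl
    rw [h0]
    simpa using Matrix.rank_le_width ((0 : Mat F 0) ^ k)
  | succ n ih =>
    intro l
    obtain ⟨m, c, hrow, rfl⟩ := exists_addBox_eq l
    obtain ⟨X, hX⟩ := ih m
    -- A suitable bordering vector exists because the number of such vectors is positive.
    have hpos : (0 : ℝ) < ((Finset.univ.filter fun x : Fin n → F => borderRow X x = c).card : ℝ) := by
      rw [hX.card_borderRow_eq]
      exact mul_pos (pow_pos (by exact_mod_cast Fintype.card_pos) _)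
        (pieriCoeff_pos inv_card_pos inv_card_lt_one hrow)
    obtain ⟨x, hx⟩ := Finset.card_pos.1 (Nat.cast_pos.1 hpos)
    refine ⟨GLBHarmonic.bordered X x, ?_⟩
    rw [← (Finset.mem_filter.1 hx).2]
    exact hX.bordered x

end Bordered

/-! ### Sums over the links of an orbit -/

/-- Linear maps that restrict to mutually inverse maps of two convex cones. -/
def coneEquiv {E E' : Type*} [AddCommGroup E] [Module ℝ E] [AddCommGroup E'] [Module ℝ E']
    (C : PointedCone ℝ E) (C' : PointedCone ℝ E') (T : E →ₗ[ℝ] E') (S : E' →ₗ[ℝ] E)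
    (hT : ∀ x ∈ C, T x ∈ C') (hS : ∀ x ∈ C', S x ∈ C) (hST : ∀ x ∈ C, S (T x) = x)
    (hTS : ∀ x ∈ C', T (S x) = x) : C ≃ₗ[{c : ℝ // 0 ≤ c}] C' where
  toFun x := ⟨T x, hT x x.2⟩
  invFun x := ⟨S x, hS x x.2⟩
  map_add' x y := Subtype.ext (map_add T (x : E) y)
  map_smul' c x := Subtype.ext (map_smul T (c : ℝ) (x : E))
  left_inv x := Subtype.ext (hST x x.2)
  right_inv x := Subtype.ext (hTS x x.2)

/-- Graded graphs with the same vertices whose weights differ by a change of normalization have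
isomorphic cones of positive harmonic functions. -/
theorem nonempty_harm_equiv (Γ : WeightedGradedGraph.{u}) (Γ' : WeightedGradedGraph.{v})
    (e : ∀ n, Γ.level n ≃ Γ'.level n) (g : ∀ n, Γ'.level n → ℝ) (hg : ∀ n l, 0 < g n l)
    (h : ∀ n v (f : Γ'.level (n + 1) → ℝ),
      ∑ w, Γ.weight n w v * (g (n + 1) (e (n + 1) w) * f (e (n + 1) w)) =
        g n (e n v) * ∑ w, Γ'.weight n w (e n v) * f w) :
    Nonempty (Harm Γ ≃ₗ[{c : ℝ // 0 ≤ c}] Harm Γ') := by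
  let T : (∀ n, Γ.level n → ℝ) →ₗ[ℝ] (∀ n, Γ'.level n → ℝ) :=
    { toFun := fun f n l => (g n l)⁻¹ * f n ((e n).symm l)
      map_add' := fun _ _ => by funext n l; exact mul_add _ _ _
      map_smul' := fun _ _ => by funext n l; exact mul_left_comm _ _ _ }
  let S : (∀ n, Γ'.level n → ℝ) →ₗ[ℝ] (∀ n, Γ.level n → ℝ) :=
    { toFun := fun f n l => g n (e n l) * f n (e n l)
      map_add' := fun _ _ => by funext n l; exact mul_add _ _ _
      map_smul' := fun _ _ => by funext n l; exact mul_left_comm _ _ _ }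
  have hT : ∀ f n l, T f n l = (g n l)⁻¹ * f n ((e n).symm l) := fun _ _ _ => rfl
  have hS : ∀ f n l, S f n l = g n (e n l) * f n (e n l) := fun _ _ _ => rfl
  have hST : ∀ f, S (T f) = f := fun f => by
    funext n l
    rw [hS, hT, Equiv.symm_apply_apply, mul_inv_cancel_left₀ (hg n _).ne']
  have hTS : ∀ f, T (S f) = f := fun f => by
    funext n l
    rw [hT, hS, Equiv.apply_symm_apply, inv_mul_cancel_left₀ (hg n _).ne']
  have hsum : ∀ f n v, ∑ w, Γ.weight n w v * S f (n + 1) w =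
      g n (e n v) * ∑ w, Γ'.weight n w (e n v) * f (n + 1) w := fun f n v => h n v (f (n + 1))
  have hmem : ∀ f, S f ∈ Harm Γ ↔ f ∈ Harm Γ' := by
    intro f
    constructor
    · rintro ⟨h1, h2⟩
      refine ⟨fun n l => ?_, fun n l => ?_⟩
      · have h := h1 n ((e n).symm l)
        rw [hS, Equiv.apply_symm_apply] at h
        exact nonneg_of_mul_nonneg_right h (hg n l)
      · have h := h2 n ((e n).symm l)
        rw [hsum, hS, Equiv.apply_symm_apply] at h
        exact mul_left_cancel₀ (hg n l).ne' h
    · rintro ⟨h1, h2⟩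
      refine ⟨fun n l => mul_nonneg (hg n _).le (h1 n _), fun n l => ?_⟩
      rw [hsum, ← h2, hS]
  exact ⟨coneEquiv _ _ T S (fun f hf => (hmem _).1 ((hST f).symm ▸ hf))
    (fun f hf => (hmem f).2 hf) (fun f _ => hST f) fun f _ => hTS f⟩

section Link

variable {F : Type u} [Field F] {n : ℕ}

theorem sum_link_mul [Fintype F] [Fintype (Orbit F (n + 1))] (m : Orbit F n)
    (f : Orbit F (n + 1) → ℝ) :
    ∑ l, (link n l m : ℝ) * f l =
      ∑ x : Fin n → F, f (ConjClasses.mk (bordered (Quotient.out m) x)) := by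
  classical
  rw [← Finset.sum_fiberwise (s := Finset.univ)
    (g := fun x : Fin n → F => ConjClasses.mk (bordered (Quotient.out m) x))]
  refine Finset.sum_congr rfl fun l _ => ?_
  rw [link, Nat.card_eq_fintype_card, Fintype.card_subtype, ← nsmul_eq_mul, ← Finset.sum_const]
  refine Finset.sum_congr rfl fun x hx => ?_
  rw [(Finset.mem_filter.1 hx).2]

/-- Conjugate by the block diagonal matrix with blocks `c` and `1`. -/
theorem isConj_bordered {X Y : Mat F n} {c : (Mat F n)ˣ} (h : SemiconjBy (c : Mat F n) X Y)
    (x : Fin n → F) : IsConj (bordered X x) (bordered Y ((c : Mat F n).mulVec x)) := by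
  let r : Matrix (Fin n ⊕ Fin 1) (Fin n ⊕ Fin 1) F → Mat F (n + 1) :=
    Matrix.reindex finSumFinEquiv finSumFinEquiv
  have hr : ∀ M N, r M * r N = r (M * N) := fun M N => Matrix.submatrix_mul_equiv M N _ _ _
  have hr1 : r 1 = 1 := by simp [r]
  have hinv : ∀ a b : Mat F n, a * b = 1 →
      r (Matrix.fromBlocks a 0 0 1) * r (Matrix.fromBlocks b 0 0 1) = 1 := by
    intro a b hab
    rw [hr, Matrix.fromBlocks_multiply]
    simp [hab, hr1, Matrix.fromBlocks_one]
  refine ⟨⟨_, _, hinv _ _ c.mul_inv, hinv _ _ c.inv_mul⟩, ?_⟩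
  change r _ * r _ = r _ * r _
  rw [hr, hr, Matrix.fromBlocks_multiply, Matrix.fromBlocks_multiply]
  simp only [Matrix.mul_zero, Matrix.zero_mul, add_zero, zero_add, Matrix.mul_one, h.eq]
  congr 2

theorem sum_bordered_eq_of_isConj [Fintype F] {X Y : Mat F n} (h : IsConj X Y)
    (f : Orbit F (n + 1) → ℝ) :
    ∑ x, f (ConjClasses.mk (bordered X x)) = ∑ x, f (ConjClasses.mk (bordered Y x)) := by
  obtain ⟨c, hc⟩ := h
  let e : (Fin n → F) ≃ (Fin n → F) :=
    { toFun := (c : Mat F n).mulVec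
      invFun := ((c⁻¹ : (Mat F n)ˣ) : Mat F n).mulVec
      left_inv := fun x => by rw [Matrix.mulVec_mulVec, c.inv_mul, Matrix.one_mulVec]
      right_inv := fun x => by rw [Matrix.mulVec_mulVec, c.mul_inv, Matrix.one_mulVec] }
  rw [← Equiv.sum_comp e fun x => f (ConjClasses.mk (bordered Y x))]
  refine Finset.sum_congr rfl fun x _ => ?_
  rw [ConjClasses.mk_eq_mk_iff_isConj.2 (isConj_bordered hc x)]
  rfl

theorem IsNilpotent.of_isConj {R : Type*} [Ring R] {X Y : R} (h : IsNilpotent X)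
    (hXY : IsConj X Y) : IsNilpotent Y := by
  obtain ⟨c, hc⟩ := hXY
  obtain ⟨k, hk⟩ := h
  refine ⟨k, ?_⟩
  have := hc.pow_right k
  rw [hk] at this
  exact (Units.mul_left_eq_zero c).1 (this.eq.symm.trans (mul_zero _))

theorem isNilpotentOrbit_mk {X : Mat F n} : IsNilpotentOrbit (ConjClasses.mk X) ↔ IsNilpotent X :=
  ⟨fun h => h X rfl, fun h _ hY =>
    IsNilpotent.of_isConj h (ConjClasses.mk_eq_mk_iff_isConj.1 hY).symm⟩

theorem mk_out_orbit (l : Orbit F n) : ConjClasses.mk (Quotient.out l) = l := Quotient.out_eq l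

theorem isNilpotent_out {l : Orbit F n} : IsNilpotent (Quotient.out l) ↔ IsNilpotentOrbit l := by
  rw [← isNilpotentOrbit_mk, mk_out_orbit]

theorem bordered_eq_zero {X : Mat F n} {x : Fin n → F} (h : bordered X x = 0) : X = 0 := by
  have h' : Matrix.fromBlocks X (Matrix.replicateCol (Fin 1) x) 0 0 = 0 :=
    (Matrix.reindex finSumFinEquiv finSumFinEquiv).injective h
  exact (Matrix.toBlocks_fromBlocks₁₁ X (Matrix.replicateCol (Fin 1) x) 0 0).symm.trans
    (congrArg Matrix.toBlocks₁₁ h')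

/-- The powers of a bordered matrix are again bordered, with the power of `X` in the corner. -/
theorem isNilpotent_bordered {X : Mat F n} {x : Fin n → F} :
    IsNilpotent (bordered X x) ↔ IsNilpotent X := by
  constructor
  · rintro ⟨k, hk⟩
    refine ⟨k + 1, bordered_eq_zero (x := (X ^ k).mulVec x) ?_⟩
    rw [← bordered_pow_succ, pow_succ, hk, zero_mul]
  · rintro ⟨k, hk⟩
    refine ⟨k + 1, ?_⟩
    rw [bordered_pow_succ, pow_succ, hk, zero_mul, Matrix.zero_mulVec, bordered]
    have : Matrix.replicateCol (Fin 1) (0 : Fin n → F) = 0 := rfl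
    rw [this, Matrix.fromBlocks_zero]
    rfl

theorem IsNilpotentOrbit.mk_bordered {m : Orbit F n} (h : IsNilpotentOrbit m) (x : Fin n → F) :
    IsNilpotentOrbit (ConjClasses.mk (bordered (Quotient.out m) x)) :=
  isNilpotentOrbit_mk.2 (isNilpotent_bordered.2 (isNilpotent_out.2 h))

/-- Extension by zero of a function on the nilpotent orbits. -/
def extendZero (f : {l : Orbit F n // IsNilpotentOrbit l} → ℝ) (l : Orbit F n) : ℝ :=
  open Classical in if h : IsNilpotentOrbit l then f ⟨l, h⟩ else 0

theorem extendZero_coe (f : {l : Orbit F n // IsNilpotentOrbit l} → ℝ)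
    (l : {l : Orbit F n // IsNilpotentOrbit l}) : extendZero f l.1 = f l := by
  rw [extendZero, dif_pos l.2]

theorem extendZero_of_not (f : {l : Orbit F n // IsNilpotentOrbit l} → ℝ)
    {l : Orbit F n} (h : ¬ IsNilpotentOrbit l) : extendZero f l = 0 := by
  rw [extendZero, dif_neg h]

theorem sum_nilpotent_mul [Fintype (Orbit F n)] [Fintype {l : Orbit F n // IsNilpotentOrbit l}]
    (g : Orbit F n → ℝ) (f : {l : Orbit F n // IsNilpotentOrbit l} → ℝ) :
    ∑ l : {l : Orbit F n // IsNilpotentOrbit l}, g l.1 * f l = ∑ l, g l * extendZero f l := by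
  refine Finset.sum_of_injOn Subtype.val Subtype.val_injective.injOn (fun _ _ => Finset.mem_coe.2 (Finset.mem_univ _)) ?_ ?_
  · intro l _ hl
    rw [extendZero_of_not, mul_zero]
    exact fun h => hl ⟨⟨l, h⟩, by simp, rfl⟩
  · intro l _
    rw [extendZero_coe]

theorem sum_link_mul_nilpotent [Fintype F] [Fintype {l : Orbit F (n + 1) // IsNilpotentOrbit l}]
    {m : Orbit F n} (hm : IsNilpotentOrbit m)
    (f : {l : Orbit F (n + 1) // IsNilpotentOrbit l} → ℝ) :
    ∑ l : {l : Orbit F (n + 1) // IsNilpotentOrbit l}, (link n l.1 m : ℝ) * f l =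
      ∑ x : Fin n → F, f ⟨ConjClasses.mk (bordered (Quotient.out m) x), hm.mk_bordered x⟩ := by
  have : Fintype (Orbit F (n + 1)) := Fintype.ofFinite _
  rw [sum_nilpotent_mul fun l => (link n l m : ℝ), sum_link_mul]
  exact Finset.sum_congr rfl fun x _ => extendZero_coe f ⟨_, hm.mk_bordered x⟩

end Link

/-! ### Nilpotent orbits and partitions -/

section NilpotentOrbits

variable {F : Type u} [Field F]

/-- The Jordan type of a nilpotent orbit. -/
def orbitType [Finite F] {n : ℕ} (l : {l : Orbit F n // IsNilpotentOrbit l}) : n.Partition :=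
  (exists_hasType (isNilpotent_out.2 l.2)).choose

theorem hasType_orbitType [Finite F] {n : ℕ} (l : {l : Orbit F n // IsNilpotentOrbit l}) :
    HasType (Quotient.out l.1) (orbitType l) :=
  (exists_hasType (isNilpotent_out.2 l.2)).choose_spec

theorem orbitType_mk [Finite F] {n : ℕ} {X : Mat F n} {m : n.Partition} (h : HasType X m)
    (hX : IsNilpotentOrbit (ConjClasses.mk X)) : orbitType ⟨ConjClasses.mk X, hX⟩ = m :=
  (hasType_orbitType _).unique
    (h.of_isConj (ConjClasses.mk_eq_mk_iff_isConj.1 (mk_out_orbit _)).symm)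

/-- Nilpotent orbits are classified by their Jordan types. -/
def orbitTypeEquiv (F : Type u) [Field F] [Finite F] (n : ℕ) :
    {l : Orbit F n // IsNilpotentOrbit l} ≃ n.Partition :=
  Equiv.ofBijective orbitType <| by
    constructor
    · intro l l' h
      have h1 := hasType_orbitType l
      rw [h] at h1
      have := ConjClasses.mk_eq_mk_iff_isConj.2 (h1.isConj (hasType_orbitType l'))
      rw [mk_out_orbit, mk_out_orbit] at this
      exact Subtype.ext this
    · intro m
      obtain ⟨X, hX⟩ := exists_matrix_hasType F n m
      exact ⟨⟨ConjClasses.mk X, isNilpotentOrbit_mk.2 hX.isNilpotent⟩, orbitType_mk hX _⟩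

theorem sum_link_mul_orbitType [Fintype F] {n : ℕ}
    [Fintype {l : Orbit F (n + 1) // IsNilpotentOrbit l}]
    (v : {l : Orbit F n // IsNilpotentOrbit l}) (g : (n + 1).Partition → ℝ) :
    ∑ l : {l : Orbit F (n + 1) // IsNilpotentOrbit l},
        (link n l.1 v.1 : ℝ) * g (orbitTypeEquiv F (n + 1) l) =
      ∑ c ∈ Finset.range (n + 1),
        (Fintype.card F : ℝ) ^ (n - conjPart (orbitTypeEquiv F n v) (c + 1)) *
        pieriCoeff ((Fintype.card F : ℝ)⁻¹) (orbitTypeEquiv F n v) c *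
          g (addBox (orbitTypeEquiv F n v) c) := by
  classical
  have h := hasType_orbitType v
  rw [sum_link_mul_nilpotent v.2 fun l => g (orbitTypeEquiv F (n + 1) l)]
  refine Eq.trans (Finset.sum_congr rfl fun x _ => ?_) (h.sum_bordered g)
  exact congrArg g (orbitType_mk (h.bordered x) _)

/-! ### The change of normalization by powers of `q` -/

/-- The statistic `n(l) = ∑_k (l'_k choose 2)` of a partition. -/
def partitionStat {n : ℕ} (l : n.Partition) : ℕ :=
  ∑ k ∈ Finset.range n, (conjPart l (k + 1)).choose 2

theorem partitionStat_addBox {n : ℕ} {m : n.Partition} {c : ℕ} (h : IsRow m c) :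
    partitionStat (addBox m c) = partitionStat m + conjPart m (c + 1) := by
  have h1 : ∀ k, (conjPart (addBox m c) (k + 1)).choose 2 =
      (conjPart m (k + 1)).choose 2 + if k = c then conjPart m (k + 1) else 0 := by
    intro k
    rw [conjPart_addBox h (by omega)]
    by_cases hk : k = c
    · rw [if_pos (by omega), if_pos hk, Nat.choose_succ_succ' _ 1, Nat.choose_one_right, add_comm]
    · rw [if_neg (by omega), if_neg hk, add_zero, add_zero]
  have hc : c ∈ Finset.range (n + 1) := Finset.mem_range.2 (Nat.lt_succ_of_le h.le)
  rw [partitionStat, Finset.sum_congr rfl fun k _ => h1 k, Finset.sum_add_distrib,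
    Finset.sum_ite_eq' _ c fun k => conjPart m (k + 1), if_pos hc, Finset.sum_range_succ,
    conjPart_eq_zero m (Nat.lt_succ_self n)]
  rfl

/-- The change of normalization between the two graphs. -/
def gauge (q : ℝ) {n : ℕ} (l : n.Partition) : ℝ := q ^ partitionStat l / q ^ n.choose 2

theorem gauge_pos {q : ℝ} (hq : 0 < q) {n : ℕ} (l : n.Partition) : 0 < gauge q l :=
  div_pos (pow_pos hq _) (pow_pos hq _)

/-- The new box lies in column `c + 1`, so it raises `n(l)` by `conjPart m (c + 1)`, while `n choose
2` grows by `n`. -/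
theorem pow_mul_gauge_addBox {q : ℝ} (hq : 0 < q) {n : ℕ} {m : n.Partition} {c : ℕ}
    (h : IsRow m c) (hm : conjPart m (c + 1) ≤ n) :
    q ^ (n - conjPart m (c + 1)) * gauge q (addBox m c) = gauge q m := by
  have hq' := hq.ne'
  rw [gauge, gauge, partitionStat_addBox h, Nat.choose_succ_succ' n 1, Nat.choose_one_right,
    ← mul_div_assoc, ← pow_add, div_eq_div_iff (pow_ne_zero _ hq') (pow_ne_zero _ hq'), ← pow_add,
    ← pow_add]
  congr 1
  simp only [Nat.reduceAdd]
  omega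

theorem sum_link_mul_gauge [Fintype F] {n : ℕ}
    [Fintype {l : Orbit F (n + 1) // IsNilpotentOrbit l}]
    (v : {l : Orbit F n // IsNilpotentOrbit l}) (g : (n + 1).Partition → ℝ) :
    ∑ l : {l : Orbit F (n + 1) // IsNilpotentOrbit l}, (link n l.1 v.1 : ℝ) *
        (gauge (Fintype.card F) (orbitTypeEquiv F (n + 1) l) * g (orbitTypeEquiv F (n + 1) l)) =
      gauge (Fintype.card F) (orbitTypeEquiv F n v) *
        ∑ l : (n + 1).Partition, (hlYoungGraph (Fintype.card F : ℝ)⁻¹).weight n l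
          (orbitTypeEquiv F n v) * g l := by
  have hq : (0 : ℝ) < Fintype.card F := by exact_mod_cast Fintype.card_pos
  rw [sum_link_mul_orbitType v fun l => gauge (Fintype.card F) l * g l,
    sum_hlYoungGraph_weight inv_card_pos inv_card_lt_one, Finset.mul_sum]
  refine Finset.sum_congr rfl fun c _ => ?_
  by_cases hc : pieriCoeff ((Fintype.card F : ℝ)⁻¹) (orbitTypeEquiv F n v) c = 0
  · simp [hc]
  · rw [← pow_mul_gauge_addBox hq (isRow_of_pieriCoeff_ne_zero hc)
      ((conjPart_le_len _ _).trans (len_le _))]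
    ring

/-- The harmonic functions on the nilpotent part of `Γ^GLB` and on the deformed Young graph. -/
theorem nonempty_harm_gammaGLBZero_equiv (F : Type u) [Field F] [Fintype F] :
    Nonempty (Harm (gammaGLBZero F) ≃ₗ[{c : ℝ // 0 ≤ c}]
      Harm (hlYoungGraph ((Fintype.card F : ℝ)⁻¹))) :=
  nonempty_harm_equiv (gammaGLBZero F) (hlYoungGraph ((Fintype.card F : ℝ)⁻¹)) (orbitTypeEquiv F)
    (fun _ l => gauge (Fintype.card F) l)
    (fun _ l => gauge_pos (by exact_mod_cast Fintype.card_pos) l)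
    fun n v f => @sum_link_mul_gauge F _ _ n ((gammaGLBZero F).fintypeLevel (n + 1)) v f

end NilpotentOrbits

/-! ### Functionals on `A_q` -/

section Functionals

open scoped DirectSum TensorProduct

variable {F : Type u} [Field F]

theorem isConj_transpose {n : ℕ} {X Y : Mat F n} (h : IsConj X Y) :
    IsConj X.transpose Y.transpose := by
  obtain ⟨c, hc⟩ := h
  refine IsConj.symm ⟨⟨(c : Mat F n).transpose, ((c⁻¹ : (Mat F n)ˣ) : Mat F n).transpose, ?_, ?_⟩, ?_⟩
  · rw [← Matrix.transpose_mul, c.inv_mul, Matrix.transpose_one]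
  · rw [← Matrix.transpose_mul, c.mul_inv, Matrix.transpose_one]
  · change (c : Mat F n).transpose * _ = _ * (c : Mat F n).transpose
    rw [← Matrix.transpose_mul, ← Matrix.transpose_mul, hc.eq]

/-- The orbit of the transposed matrices. -/
def transposeOrbit {n : ℕ} (l : Orbit F n) : Orbit F n :=
  ConjClasses.mk (Quotient.out l).transpose

theorem transposeOrbit_mk {n : ℕ} (X : Mat F n) :
    transposeOrbit (ConjClasses.mk X) = ConjClasses.mk X.transpose :=
  ConjClasses.mk_eq_mk_iff_isConj.2
    (isConj_transpose (ConjClasses.mk_eq_mk_iff_isConj.1 (mk_out_orbit _)))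

theorem transposeOrbit_transposeOrbit {n : ℕ} (l : Orbit F n) :
    transposeOrbit (transposeOrbit l) = l := by
  obtain ⟨X, rfl⟩ := ConjClasses.mk_surjective l
  rw [transposeOrbit_mk, transposeOrbit_mk, Matrix.transpose_transpose]

theorem isNilpotentOrbit_transposeOrbit {n : ℕ} {l : Orbit F n} :
    IsNilpotentOrbit (transposeOrbit l) ↔ IsNilpotentOrbit l := by
  rw [transposeOrbit, isNilpotentOrbit_mk, ← isNilpotent_out]
  simp only [IsNilpotent, ← Matrix.transpose_pow, Matrix.transpose_eq_zero]

/-- Reindexing is conjugation by a permutation matrix. The family `c` over all sizes permits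
comparison of orbits in the sizes `1 + n` and `n + 1`. -/
theorem eq_mk_reindex (c : ∀ n, Orbit F n → ℝ) {m k : ℕ} (σ : Fin m ≃ Fin k) (X : Mat F m) :
    c k (ConjClasses.mk (Matrix.reindex σ σ X)) = c m (ConjClasses.mk X) := by
  obtain rfl : m = k := by simpa using Fintype.card_congr σ
  congr 1
  refine ConjClasses.mk_eq_mk_iff_isConj.2 (IsConj.symm ⟨⟨σ.symm.toPEquiv.toMatrix,
    σ.toPEquiv.toMatrix, ?_, ?_⟩, ?_⟩)
  · rw [← PEquiv.toMatrix_trans, ← Equiv.toPEquiv_trans, Equiv.symm_trans_self,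
      Equiv.toPEquiv_refl, PEquiv.toMatrix_refl]
  · rw [← PEquiv.toMatrix_trans, ← Equiv.toPEquiv_trans, Equiv.self_trans_symm,
      Equiv.toPEquiv_refl, PEquiv.toMatrix_refl]
  · change σ.symm.toPEquiv.toMatrix * X = Matrix.reindex σ σ X * σ.symm.toPEquiv.toMatrix
    rw [PEquiv.toMatrix_toPEquiv_mul, PEquiv.mul_toMatrix_toPEquiv]
    ext i j
    simp

theorem chi_of_eq {n : ℕ} {l : Orbit F n} {X : Mat F n} (h : ConjClasses.mk X = l) :
    (chi l).1 X = 1 :=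
  if_pos h

theorem chi_of_ne {n : ℕ} {l : Orbit F n} {X : Mat F n} (h : ConjClasses.mk X ≠ l) :
    (chi l).1 X = 0 :=
  if_neg h

theorem linearMap_ext_lof {φ ψ : A F →ₗ[ℝ] ℝ}
    (h : ∀ n g, φ (DirectSum.lof ℝ ℕ (fun n => invFun F n) n g) =
      ψ (DirectSum.lof ℝ ℕ (fun n => invFun F n) n g)) : φ = ψ :=
  DirectSum.linearMap_ext ℝ fun n => LinearMap.ext fun g => h n g

/-- The matrix with rows `(0, y)` and `(0, B)`. -/
def rowBordered {n : ℕ} (B : Mat F n) (y : Fin n → F) : Mat F (1 + n) :=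
  Matrix.reindex finSumFinEquiv finSumFinEquiv
    (Matrix.fromBlocks 0 (Matrix.replicateRow (Fin 1) y) 0 B)

theorem blocks_rowBordered {n : ℕ} (B : Mat F n) (y : Fin n → F) :
    blocks (rowBordered B y) = Matrix.fromBlocks 0 (Matrix.replicateRow (Fin 1) y) 0 B := by
  simp [blocks, rowBordered]

theorem apply_mk_transpose_rowBordered (c : ∀ n, Orbit F n → ℝ) {n : ℕ} (B : Mat F n)
    (y : Fin n → F) : c (1 + n) (ConjClasses.mk (rowBordered B y).transpose) =
      c (n + 1) (ConjClasses.mk (bordered B.transpose y)) := by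
  let σ : Fin (n + 1) ≃ Fin (1 + n) :=
    finSumFinEquiv.symm.trans ((Equiv.sumComm (Fin n) (Fin 1)).trans finSumFinEquiv)
  rw [← eq_mk_reindex c σ]
  congr 2
  ext i j
  obtain ⟨i, rfl⟩ := finSumFinEquiv.surjective i
  obtain ⟨j, rfl⟩ := finSumFinEquiv.surjective j
  rcases i with i | i <;> rcases j with j | j <;>
    simp [σ, rowBordered, bordered, -finSumFinEquiv_apply_left, -finSumFinEquiv_apply_right]

theorem extend_chi_rowBordered {n : ℕ} (g : invFun F n) (B : Mat F n) (y : Fin n → F) :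
    extend (chi (ConjClasses.mk (0 : Mat F 1))).1 g.1 (rowBordered B y) = g.1 B := by
  rw [extend, if_pos, blocks_rowBordered, Matrix.toBlocks_fromBlocks₁₁,
    Matrix.toBlocks_fromBlocks₂₂]
  · rw [chi_of_eq rfl, one_mul]
  · rw [IsParabolic, blocks_rowBordered, Matrix.toBlocks_fromBlocks₂₁]

/-- The orbit of the zero matrix is a single point, so the first diagonal block must vanish. -/
theorem exists_rowBordered_of_extend_ne_zero {n : ℕ} {g : invFun F n} {X : Mat F (1 + n)}
    (h : extend (chi (ConjClasses.mk (0 : Mat F 1))).1 g.1 X ≠ 0) :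
    ∃ B y, rowBordered B y = X := by
  unfold extend at h
  split_ifs at h with hX
  · have h0 : (blocks X).toBlocks₁₁ = 0 := by
      have h1 : ConjClasses.mk (blocks X).toBlocks₁₁ = ConjClasses.mk 0 := by
        by_contra h1
        exact left_ne_zero_of_mul h (chi_of_ne h1)
      obtain ⟨c, hc⟩ := ConjClasses.mk_eq_mk_iff_isConj.1 h1
      exact (Units.mul_right_eq_zero c).1 (hc.eq.trans (zero_mul _))
    refine ⟨(blocks X).toBlocks₂₂, (blocks X).toBlocks₁₂ 0, ?_⟩
    apply (Matrix.reindex finSumFinEquiv.symm finSumFinEquiv.symm).injective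
    change blocks (rowBordered _ _) = blocks X
    rw [blocks_rowBordered, ← Matrix.fromBlocks_toBlocks (blocks X), h0, hX]
    congr 1
    ext i j
    rw [Subsingleton.elim i 0]
    rfl
  · exact absurd rfl h

theorem isConj_conjInv {n : ℕ} (s : GL (Fin n) F) (X : Mat F n) : IsConj (conjInv s X) X :=
  ⟨s, by
    change (s : Mat F n) * (((s⁻¹ : GL (Fin n) F) : Mat F n) * X * s) = X * s
    rw [← mul_assoc, ← mul_assoc, s.mul_inv, one_mul]⟩

/-- Extension by zero of a function on the nilpotent orbits of all sizes. -/
def extendZeroMap (F : Type u) [Field F] :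
    (∀ n, {l : Orbit F n // IsNilpotentOrbit l} → ℝ) →ₗ[ℝ] (∀ n, Orbit F n → ℝ) where
  toFun f n := extendZero (f n)
  map_add' f g := by
    funext n l
    by_cases h : IsNilpotentOrbit l
    · simp [extendZero, h]
    · simp [extendZero, h]
  map_smul' c f := by
    funext n l
    by_cases h : IsNilpotentOrbit l
    · simp [extendZero, h]
    · simp [extendZero, h]

variable [Fintype F]

/-! ### Functions on orbits and functionals on `A_q` -/

/-- The number of matrices in an orbit. -/
def orbitSize {n : ℕ} (l : Orbit F n) : ℕ := Nat.card {X : Mat F n // ConjClasses.mk X = l}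

theorem orbitSize_pos {n : ℕ} (l : Orbit F n) : 0 < orbitSize l := by
  have : Nonempty {X : Mat F n // ConjClasses.mk X = l} := ⟨⟨_, mk_out_orbit l⟩⟩
  exact Nat.card_pos

theorem sum_chi_mul {n : ℕ} (l : Orbit F n) (f : Mat F n → ℝ) (a : ℝ)
    (h : ∀ X, ConjClasses.mk X = l → f X = a) : ∑ X, (chi l).1 X * f X = orbitSize l * a := by
  classical
  have : ∀ X, (chi l).1 X * f X = if ConjClasses.mk X = l then a else 0 := by
    intro X
    by_cases hX : ConjClasses.mk X = l
    · rw [chi_of_eq hX, h X hX, one_mul, if_pos hX]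
    · rw [chi_of_ne hX, zero_mul, if_neg hX]
  rw [Finset.sum_congr rfl fun X _ => this X, ← Finset.sum_filter, Finset.sum_const,
    nsmul_eq_mul, orbitSize, Nat.card_eq_fintype_card, Fintype.card_subtype]

/-- The number of cosets of the parabolic subgroup `P_{1,n}`. -/
def cosetCount (F : Type u) [Field F] (n : ℕ) : ℕ :=
  Nat.card (GL (Fin (1 + n)) F ⧸ parabolic F 1 n)

theorem cosetCount_pos (n : ℕ) : 0 < cosetCount F n := Nat.card_pos

/-- The normalization of the functional attached to a function on the orbits. -/
def normalization (F : Type u) [Field F] (n : ℕ) : ℝ :=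
  ∏ i ∈ Finset.range n, (cosetCount F i : ℝ)⁻¹

theorem normalization_pos (n : ℕ) : 0 < normalization F n :=
  Finset.prod_pos fun i _ => inv_pos.2 (by exact_mod_cast cosetCount_pos i)

theorem normalization_succ (n : ℕ) :
    normalization F (n + 1) * cosetCount F n = normalization F n := by
  have : (cosetCount F n : ℝ) ≠ 0 := by exact_mod_cast (cosetCount_pos (F := F) n).ne'
  rw [normalization, Finset.prod_range_succ, mul_assoc, inv_mul_cancel₀ this, mul_one]
  rfl

/-- The component of degree `n` of the functional attached to a function on the orbits. -/
def functionalComponent (f : ∀ n, Orbit F n → ℝ) (n : ℕ) : invFun F n →ₗ[ℝ] ℝ where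
  toFun g := normalization F n * ∑ X, g.1 X * f n (ConjClasses.mk X.transpose)
  map_add' g g' := by
    simp only [Submodule.coe_add, Pi.add_apply, add_mul, Finset.sum_add_distrib, mul_add]
  map_smul' c g := by
    simp only [Submodule.coe_smul, Pi.smul_apply, smul_eq_mul, mul_assoc, ← Finset.mul_sum,
      RingHom.id_apply]
    ring

theorem invFun_eq_sum_chi {n : ℕ} [Fintype (Orbit F n)] (g : invFun F n) :
    g = ∑ l : Orbit F n, g.1 (Quotient.out l) • chi l := by
  classical
  have hconst : ∀ X Y : Mat F n, IsConj X Y → g.1 X = g.1 Y := by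
    rintro X Y ⟨c, hc⟩
    rw [← g.2 c X, hc.eq, mul_assoc, ← Units.val_mul, mul_inv_cancel, Units.val_one, mul_one]
  ext X
  rw [AddSubmonoidClass.coe_finsetSum, Finset.sum_apply]
  have : ∀ l : Orbit F n, (g.1 (Quotient.out l) • chi l : invFun F n).1 X =
      if ConjClasses.mk X = l then g.1 X else 0 := by
    intro l
    change g.1 (Quotient.out l) * (chi l).1 X = _
    by_cases h : ConjClasses.mk X = l
    · rw [chi_of_eq h, if_pos h, mul_one]
      exact hconst _ _ (ConjClasses.mk_eq_mk_iff_isConj.1 ((mk_out_orbit l).trans h.symm))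
    · rw [chi_of_ne h, if_neg h, mul_zero]
  rw [Finset.sum_congr rfl fun l _ => this l, Finset.sum_ite_eq, if_pos (Finset.mem_univ _)]

theorem linearMap_ext_chiA {φ ψ : A F →ₗ[ℝ] ℝ}
    (h : ∀ n (l : Orbit F n), φ (chiA l) = ψ (chiA l)) : φ = ψ := by
  refine linearMap_ext_lof fun n g => ?_
  have : Fintype (Orbit F n) := Fintype.ofFinite _
  rw [invFun_eq_sum_chi g]
  simp only [map_sum, map_smul]
  exact Finset.sum_congr rfl fun l _ => congrArg _ (h n l)

/-- The functional on `A_q` attached to a function on the orbits. -/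
def functional : (∀ n, Orbit F n → ℝ) →ₗ[ℝ] (A F →ₗ[ℝ] ℝ) where
  toFun f := DirectSum.toModule ℝ ℕ ℝ (functionalComponent f)
  map_add' f f' := linearMap_ext_lof fun n g => by
    rw [LinearMap.add_apply, DirectSum.toModule_lof, DirectSum.toModule_lof, DirectSum.toModule_lof]
    simp only [functionalComponent, LinearMap.coe_mk, AddHom.coe_mk, Pi.add_apply, mul_add,
      Finset.sum_add_distrib]
  map_smul' c f := linearMap_ext_lof fun n g => by
    rw [LinearMap.smul_apply, DirectSum.toModule_lof, DirectSum.toModule_lof]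
    simp only [functionalComponent, LinearMap.coe_mk, AddHom.coe_mk, Pi.smul_apply, smul_eq_mul,
      mul_left_comm _ c, ← Finset.mul_sum, RingHom.id_apply]

theorem functional_lof (f : ∀ n, Orbit F n → ℝ) (n : ℕ) (g : invFun F n) :
    functional f (DirectSum.lof ℝ ℕ (fun n => invFun F n) n g) =
      normalization F n * ∑ X, g.1 X * f n (ConjClasses.mk X.transpose) := by
  change DirectSum.toModule ℝ ℕ ℝ (functionalComponent f) _ = _
  rw [DirectSum.toModule_lof]
  rfl

theorem functional_chiA (f : ∀ n, Orbit F n → ℝ) {n : ℕ} (l : Orbit F n) :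
    functional f (chiA l) = normalization F n * (orbitSize l * f n (transposeOrbit l)) := by
  rw [chiA, functional_lof, sum_chi_mul l _ (f n (transposeOrbit l))]
  rintro X rfl
  rw [transposeOrbit_mk]

theorem normalization_mul_orbitSize_pos {n : ℕ} (l : Orbit F n) :
    0 < normalization F n * orbitSize l :=
  mul_pos (normalization_pos n) (by exact_mod_cast orbitSize_pos l)

/-- The function on the orbits attached to a functional on `A_q`. -/
def orbitFunction (F : Type u) [Field F] [Fintype F] :
    (A F →ₗ[ℝ] ℝ) →ₗ[ℝ] (∀ n, Orbit F n → ℝ) where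
  toFun φ n l := φ (chiA (transposeOrbit l)) / (normalization F n * orbitSize (transposeOrbit l))
  map_add' _ _ := by
    funext n l
    exact add_div _ _ _
  map_smul' _ _ := by
    funext n l
    exact mul_div_assoc _ _ _

theorem orbitFunction_apply (φ : A F →ₗ[ℝ] ℝ) (n : ℕ) (l : Orbit F n) :
    orbitFunction F φ n l =
      φ (chiA (transposeOrbit l)) / (normalization F n * orbitSize (transposeOrbit l)) := rfl

theorem orbitFunction_functional (f : ∀ n, Orbit F n → ℝ) :
    orbitFunction F (functional f) = f := by
  funext n l
  rw [orbitFunction_apply, functional_chiA, ← mul_assoc,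
    mul_div_cancel_left₀ _ (normalization_mul_orbitSize_pos _).ne', transposeOrbit_transposeOrbit]

theorem functional_orbitFunction (φ : A F →ₗ[ℝ] ℝ) :
    functional (orbitFunction F φ) = φ := by
  refine linearMap_ext_chiA fun n l => ?_
  rw [functional_chiA, ← mul_assoc, orbitFunction_apply, transposeOrbit_transposeOrbit,
    mul_div_cancel₀ _ (normalization_mul_orbitSize_pos _).ne']

/-! ### Invariance under `x_1` as harmonicity -/

theorem nabla_lof (i j : ℕ) (f : invFun F i) (g : invFun F j) :
    nabla F (DirectSum.lof ℝ ℕ (fun n => invFun F n) i f ⊗ₜ[ℝ]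
      DirectSum.lof ℝ ℕ (fun n => invFun F n) j g) =
    DirectSum.lof ℝ ℕ (fun n => invFun F n) (i + j) (parInd F i j f g) := by
  rw [nabla, TensorProduct.lift.tmul, DirectSum.toModule_lof, LinearMap.flip_apply,
    DirectSum.toModule_lof]
  rfl

theorem sum_extend_mul {n : ℕ} (g : invFun F n) (c : ∀ n, Orbit F n → ℝ) :
    ∑ X : Mat F (1 + n), extend (chi (ConjClasses.mk (0 : Mat F 1))).1 g.1 X *
        c (1 + n) (ConjClasses.mk X.transpose) =
      ∑ B : Mat F n, g.1 B * ∑ y, c (n + 1) (ConjClasses.mk (bordered B.transpose y)) := by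
  simp only [Finset.mul_sum]
  rw [← Finset.sum_product', Finset.univ_product_univ]
  symm
  refine Finset.sum_of_injOn (fun p : Mat F n × (Fin n → F) => rowBordered p.1 p.2) ?_
    (fun _ _ => Finset.mem_coe.2 (Finset.mem_univ _)) ?_ ?_
  · rintro ⟨B, y⟩ - ⟨B', y'⟩ - h
    have h' := congrArg blocks h
    simp only [blocks_rowBordered, Matrix.fromBlocks_inj] at h'
    exact Prod.ext h'.2.2.2 (funext fun j => congrFun (congrFun h'.2.1 0) j)
  · intro X _ hX
    by_contra h
    obtain ⟨B, y, rfl⟩ := exists_rowBordered_of_extend_ne_zero (left_ne_zero_of_mul h)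
    exact hX ⟨(B, y), by simp, rfl⟩
  · rintro ⟨B, y⟩ -
    rw [extend_chi_rowBordered, apply_mk_transpose_rowBordered c]

/-- Conjugation by a coset representative is a bijection of the matrices that preserves `c`, so all
cosets give the same sum. -/
theorem sum_indValue_mul {i j : ℕ} (f : Mat F i → ℝ) (g : Mat F j → ℝ)
    (c : Orbit F (i + j) → ℝ) :
    ∑ X, indValue f g X * c (ConjClasses.mk X) =
      Nat.card (GL (Fin (i + j)) F ⧸ parabolic F i j) *
        ∑ X, extend f g X * c (ConjClasses.mk X) := by
  let _ : Fintype (GL (Fin (i + j)) F ⧸ parabolic F i j) := Fintype.ofFinite _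
  simp only [indValue, Finset.sum_mul]
  rw [Finset.sum_comm, Nat.card_eq_fintype_card, ← nsmul_eq_mul, ← Finset.card_univ,
    ← Finset.sum_const]
  refine Finset.sum_congr rfl fun s _ => ?_
  let e : Mat F (i + j) ≃ Mat F (i + j) :=
    { toFun := conjInv (Quotient.out s)
      invFun := conjInv (Quotient.out s)⁻¹
      left_inv := fun X => by rw [← conjInv_mul, mul_inv_cancel, conjInv_one]
      right_inv := fun X => by rw [← conjInv_mul, inv_mul_cancel, conjInv_one] }
  rw [← Equiv.sum_comp e fun X => extend f g X * c (ConjClasses.mk X)]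
  refine Finset.sum_congr rfl fun X _ => ?_
  rw [ConjClasses.mk_eq_mk_iff_isConj.2 (isConj_conjInv (Quotient.out s) X).symm]
  rfl

theorem functional_nabla_lof (f : ∀ n, Orbit F n → ℝ) {n : ℕ} (g : invFun F n) :
    functional f (nabla F (xOne F ⊗ₜ[ℝ] DirectSum.lof ℝ ℕ (fun n => invFun F n) n g)) =
      normalization F n *
        ∑ B : Mat F n, g.1 B * ∑ y, f (n + 1) (ConjClasses.mk (bordered B.transpose y)) := by
  rw [xOne, chiA, nabla_lof, functional_lof, ← sum_extend_mul, ← normalization_succ n, mul_assoc]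
  have h := sum_indValue_mul (chi (ConjClasses.mk (0 : Mat F 1))).1 g.1
    fun l : Orbit F (1 + n) => f (1 + n) (transposeOrbit l)
  simp only [transposeOrbit_mk] at h
  rw [cosetCount, ← h, add_comm n 1]
  rfl

theorem functional_nabla_chiA (f : ∀ n, Orbit F n → ℝ) {n : ℕ}
    [Fintype (Orbit F (n + 1))] (l : Orbit F n) :
    functional f (nabla F (xOne F ⊗ₜ[ℝ] chiA l)) = normalization F n * (orbitSize l *
      ∑ w, (link n w (transposeOrbit l) : ℝ) * f (n + 1) w) := by
  rw [chiA, functional_nabla_lof, sum_chi_mul l _ _ fun X hX => ?_]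
  rw [sum_link_mul]
  refine sum_bordered_eq_of_isConj (ConjClasses.mk_eq_mk_iff_isConj.1 ?_) (f (n + 1))
  rw [mk_out_orbit, ← hX, transposeOrbit_mk]

/-- On the indicator of `l`, both conditions are those on `f` at the transposed orbit, multiplied by
the positive number `normalization F n * orbitSize l`. Transposition being an involution, all orbits
are reached. -/
theorem functional_mem_FCone_iff (f : ∀ n, Orbit F n → ℝ) :
    functional f ∈ FCone F ↔ f ∈ Harm (gammaGLB F) := by
  have hpos : ∀ n (l m : Orbit F n), transposeOrbit l = m →
      (0 ≤ functional f (chiA l) ↔ 0 ≤ f n m) := by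
    rintro n l _ rfl
    rw [functional_chiA, ← mul_assoc]
    exact mul_nonneg_iff_of_pos_left (normalization_mul_orbitSize_pos l)
  have hharm : ∀ n (l m : Orbit F n), transposeOrbit l = m →
      (functional f (chiA l) = functional f (nabla F (xOne F ⊗ₜ[ℝ] chiA l)) ↔
        f n m = ∑ w, (gammaGLB F).weight n w m * f (n + 1) w) := by
    rintro n l _ rfl
    let _ : Fintype (Orbit F (n + 1)) := Fintype.ofFinite _
    rw [functional_chiA, functional_nabla_chiA, ← mul_assoc, ← mul_assoc]
    exact mul_right_inj' (normalization_mul_orbitSize_pos l).ne'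
  constructor
  · rintro ⟨h1, h2⟩
    exact ⟨fun n l => (hpos n _ l (transposeOrbit_transposeOrbit l)).1 (h1 n _),
      fun n l => (hharm n _ l (transposeOrbit_transposeOrbit l)).1 (h2 _)⟩
  · rintro ⟨h1, h2⟩
    refine ⟨fun n l => (hpos n l _ rfl).2 (h1 n _), ?_⟩
    have : functional f = (functional f).comp ((nabla F).comp (TensorProduct.mk ℝ _ _ (xOne F))) :=
      linearMap_ext_chiA fun n l => (hharm n l _ rfl).2 (h2 n _)
    exact fun a => LinearMap.congr_fun this a

/-- The harmonic functions on `Γ^GLB` and the cone of functionals `F(A_q)`. -/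
theorem nonempty_harm_gammaGLB_equiv (F : Type u) [Field F] [Fintype F] :
    Nonempty (Harm (gammaGLB F) ≃ₗ[{c : ℝ // 0 ≤ c}] FCone F) := by
  classical
  exact ⟨coneEquiv (Harm (gammaGLB F)) (FCone F) functional (orbitFunction F)
    (fun f hf => (functional_mem_FCone_iff f).2 hf)
    (fun φ hφ => (functional_mem_FCone_iff _).1 ((functional_orbitFunction φ).symm ▸ hφ))
    (fun f _ => orbitFunction_functional f) fun φ _ => functional_orbitFunction φ⟩

/-- At a nilpotent orbit the two equations have the same nonzero terms. At any other orbit all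
orbits linked above are non-nilpotent, and both sides vanish. -/
theorem extendZero_mem_Harm_iff (f : ∀ n, {l : Orbit F n // IsNilpotentOrbit l} → ℝ) :
    extendZeroMap F f ∈ Harm (gammaGLB F) ↔ f ∈ Harm (gammaGLBZero F) := by
  have hsum : ∀ n (v : {l : Orbit F n // IsNilpotentOrbit l}),
      ∑ w, (gammaGLBZero F).weight n w v * f (n + 1) w =
        ∑ w, (gammaGLB F).weight n w v.1 * extendZeroMap F f (n + 1) w := fun n v =>
    @sum_nilpotent_mul F _ (n + 1) ((gammaGLB F).fintypeLevel (n + 1))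
      ((gammaGLBZero F).fintypeLevel (n + 1)) (fun l => (link n l v.1 : ℝ)) (f (n + 1))
  constructor
  · rintro ⟨h1, h2⟩
    refine ⟨fun n (v : {l : Orbit F n // IsNilpotentOrbit l}) => ?_,
      fun n (v : {l : Orbit F n // IsNilpotentOrbit l}) => ?_⟩
    · have h : 0 ≤ extendZero (f n) v.1 := h1 n v.1
      rwa [extendZero_coe] at h
    · have h : extendZero (f n) v.1 = _ := h2 n v.1
      rw [extendZero_coe] at h
      exact h.trans (hsum n v).symm
  · rintro ⟨h1, h2⟩
    refine ⟨fun n (v : Orbit F n) => ?_, fun n (v : Orbit F n) => ?_⟩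
    · change 0 ≤ extendZero (f n) v
      by_cases hv : IsNilpotentOrbit v
      · rw [extendZero_coe (f n) ⟨v, hv⟩]
        exact h1 n _
      · rw [extendZero_of_not _ hv]
    · change extendZero (f n) v = _
      by_cases hv : IsNilpotentOrbit v
      · rw [extendZero_coe (f n) ⟨v, hv⟩]
        exact (h2 n ⟨v, hv⟩).trans (hsum n ⟨v, hv⟩)
      · rw [extendZero_of_not _ hv]
        let _ : Fintype (Orbit F (n + 1)) := Fintype.ofFinite _
        refine Eq.trans ?_ (sum_link_mul v (extendZero (f (n + 1)))).symm
        refine (Finset.sum_eq_zero fun x _ => extendZero_of_not _ fun h => hv ?_).symm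
        exact isNilpotent_out.1 (isNilpotent_bordered.1 (isNilpotentOrbit_mk.1 h))

/-- The harmonic functions on the nilpotent part of `Γ^GLB` and the cone `F_0(A_q)`. -/
theorem nonempty_harm_gammaGLBZero_equiv_FConeZero (F : Type u) [Field F] [Fintype F] :
    Nonempty (Harm (gammaGLBZero F) ≃ₗ[{c : ℝ // 0 ≤ c}] FConeZero F) := by
  classical
  let R : (∀ n, Orbit F n → ℝ) →ₗ[ℝ] (∀ n, {l : Orbit F n // IsNilpotentOrbit l} → ℝ) :=
    { toFun := fun f n l => f n l.1
      map_add' := fun _ _ => rfl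
      map_smul' := fun _ _ => rfl }
  have hRE : ∀ f, R (extendZeroMap F f) = f := fun f => by
    funext n l
    exact extendZero_coe (f n) l
  have hER : ∀ φ ∈ FConeZero F, extendZeroMap F (R (orbitFunction F φ)) = orbitFunction F φ := by
    rintro φ ⟨-, hφ⟩
    funext n l
    change extendZero _ l = _
    by_cases hl : IsNilpotentOrbit l
    · exact extendZero_coe (fun l => orbitFunction F φ n l.1) ⟨l, hl⟩
    · rw [extendZero_of_not _ hl, orbitFunction_apply,
        hφ n _ (isNilpotentOrbit_transposeOrbit.not.2 hl), zero_div]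
  refine ⟨coneEquiv (Harm (gammaGLBZero F)) (FConeZero F) (functional.comp (extendZeroMap F))
    (R.comp (orbitFunction F)) (fun (f : ∀ n, {l : Orbit F n // IsNilpotentOrbit l} → ℝ) hf => ⟨?_, fun n l hl => ?_⟩) (fun φ hφ => ?_)
    (fun (f : ∀ n, {l : Orbit F n // IsNilpotentOrbit l} → ℝ) _ => ?_) fun φ hφ => ?_⟩
  · exact (functional_mem_FCone_iff _).2 ((extendZero_mem_Harm_iff f).2 hf)
  · change functional (extendZeroMap F f) (chiA l) = 0
    rw [functional_chiA]
    change _ * (_ * extendZero (f n) (transposeOrbit l)) = 0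
    rw [extendZero_of_not _ (isNilpotentOrbit_transposeOrbit.not.2 hl), mul_zero, mul_zero]
  · refine (extendZero_mem_Harm_iff _).1 ?_
    change extendZeroMap F (R (orbitFunction F φ)) ∈ _
    rw [hER φ hφ, ← functional_mem_FCone_iff, functional_orbitFunction]
    exact hφ.1
  · change R (orbitFunction F (functional (extendZeroMap F f))) = f
    rw [orbitFunction_functional, hRE]
  · change functional (extendZeroMap F (R (orbitFunction F φ))) = φ
    rw [hER φ hφ, functional_orbitFunction]

end Functionals

end

end GLBHarmonic

theorem mainTheorem7 {F : Type*} [Field F] [Fintype F] :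
    Nonempty (GLBHarmonic.Harm (GLBHarmonic.gammaGLB F) ≃ₗ[{c : ℝ // 0 ≤ c}] GLBHarmonic.FCone F) ∧
    Nonempty (GLBHarmonic.Harm (GLBHarmonic.gammaGLBZero F) ≃ₗ[{c : ℝ // 0 ≤ c}]
      GLBHarmonic.Harm (GLBHarmonic.hlYoungGraph ((Fintype.card F : ℝ)⁻¹))) ∧
    Nonempty (GLBHarmonic.Harm (GLBHarmonic.gammaGLBZero F) ≃ₗ[{c : ℝ // 0 ≤ c}] GLBHarmonic.FConeZero F) := by
  exact ⟨GLBHarmonic.nonempty_harm_gammaGLB_equiv F,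
    GLBHarmonic.nonempty_harm_gammaGLBZero_equiv F,
    GLBHarmonic.nonempty_harm_gammaGLBZero_equiv_FConeZero F⟩
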